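/- Let $N\in\mathbb N$, $K\in[1,\infty)$ and $\theta\in(0,2]$. There is a constant $C=C(N,K,\theta)>0$, and for every $R>0$ there is a constant $C_R=C(N,K,\theta,R)>0$, such that the following holds. Let $B_R=B_R(x_0)$ and $B_{2R}=B_{2R}(x_0)$ be concentric open balls in $\mathbb R^N$ with arbitrary centre $x_0$. Let $F\in C^2(\mathbb R^N)$ be $K$-quasiuniformly convex, i.e. $F$ is a convex $C^1$ function which is not affine, with $DF\in W^{1,1}_{\rm loc}(\mathbb R^N)$ and $\lambda_{\max}(D^2F(z))\le K\,\lambda_{\min}(D^2F(z))$ for a.e. $z\in\mathbb R^N$, where $\lambda_{\min},\lambda_{\max}$ denote the smallest and largest eigenvalue. Let $u\in C^2(B_{2R})$ and let $f$ be a real function such that $$\operatorname{div}\big(DF(Du)\big)=f\qquad\text{a.e. in } B_{2R},$$ and put $V(x)=DF(Du(x))$. Then $$\|V\|_{W^{1,2}(B_R)}\le C\,\|f\|_{L^2(B_{2R})}+C_R\,\|V\|_{L^\theta(B_{2R})}.$$ Here $\|V\|_{W^{1,2}(B_R)}=\big(\|V\|_{L^2(B_R)}^2+\|DV\|_{L^2(B_R)}^2\big)^{1/2}$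 with $DV$ measured in the Frobenius norm, $\|V\|_{L^\theta}=\big(\int|V|^\theta\,dx\big)^{1/\theta}$ also for $\theta<1$, and the right-hand side may be $+\infty$. -/

import Mathlib

open MeasureTheory
open scoped ContDiff NNReal ENNReal Gradient

noncomputable section

/-- The Frobenius norm `|A|₂ = (∑ᵢⱼ |aᵢⱼ|²)^{1/2}` of a real square matrix. -/
def frobNorm {N : ℕ} (A : Matrix (Fin N) (Fin N) ℝ) : ℝ :=
  Real.sqrt (∑ i, ∑ j, A i j ^ 2)

/-- The smallest (real) eigenvalue of a square matrix; used for symmetric matrices, whose spectrum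
is a finite nonempty set of reals when `N ≥ 1`. -/
def lamMin {N : ℕ} (A : Matrix (Fin N) (Fin N) ℝ) : ℝ := sInf (spectrum ℝ A)

/-- The largest (real) eigenvalue of a square matrix; used for symmetric matrices. -/
def lamMax {N : ℕ} (A : Matrix (Fin N) (Fin N) ℝ) : ℝ := sSup (spectrum ℝ A)

/-- On the open set `Ω`, the vector field `V` is locally integrable and has the locally integrable
matrix field `G` as weak (distributional) derivative, `G i j = ∂ⱼ Vⁱ`; that is,
`V ∈ W^{1,1}_loc(Ω)` with `DV = G`. -/
structure HasWeakDeriv {N : ℕ} (Ω : Set (EuclideanSpace ℝ (Fin N)))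
    (V : EuclideanSpace ℝ (Fin N) → EuclideanSpace ℝ (Fin N))
    (G : EuclideanSpace ℝ (Fin N) → Matrix (Fin N) (Fin N) ℝ) : Prop where
  locInt : ∀ i, LocallyIntegrableOn (fun x => V x i) Ω volume
  locInt_deriv : ∀ i j, LocallyIntegrableOn (fun x => G x i j) Ω volume
  integral_eq : ∀ i j, ∀ φ : EuclideanSpace ℝ (Fin N) → ℝ,
    ContDiff ℝ ∞ φ → HasCompactSupport φ → tsupport φ ⊆ Ω →
      ∫ x in Ω, V x i * fderiv ℝ φ x (EuclideanSpace.single j 1) = - ∫ x in Ω, G x i j * φ x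

/-- The norm `‖V‖_{W^{1,2}(Ω)} = (‖V‖²_{L²(Ω)} + ‖DV‖²_{L²(Ω)})^{1/2}`, with values in `[0, ∞]`.
A weak derivative is unique up to null sets, so the infimum is the value at any weak derivative
`G = DV`, and it is `∞` if there is none. -/
def sobolevNorm {N : ℕ} (Ω : Set (EuclideanSpace ℝ (Fin N)))
    (V : EuclideanSpace ℝ (Fin N) → EuclideanSpace ℝ (Fin N)) : ℝ≥0∞ :=
  ⨅ (G : EuclideanSpace ℝ (Fin N) → Matrix (Fin N) (Fin N) ℝ) (_ : HasWeakDeriv Ω V G),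
    (eLpNorm V 2 (volume.restrict Ω) ^ 2
      + eLpNorm (fun x => frobNorm (G x)) 2 (volume.restrict Ω) ^ 2) ^ (1 / 2 : ℝ)

/-- `F` is `K`-quasiuniformly convex: `1 ≤ K`, `F` is a convex `C¹` function on `ℝᴺ` which is not
affine, `DF ∈ W^{1,1}_loc(ℝᴺ)`, and the (weak) Hessian satisfies
`λ_max(D²F(z)) ≤ K λ_min(D²F(z))` for a.e. `z`. -/
structure IsQuasiuniformlyConvex {N : ℕ} (K : ℝ) (F : EuclideanSpace ℝ (Fin N) → ℝ) : Prop where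
  one_le : 1 ≤ K
  convex : ConvexOn ℝ Set.univ F
  contDiff : ContDiff ℝ 1 F
  not_affine : ¬ ∃ (a : EuclideanSpace ℝ (Fin N)) (b : ℝ), ∀ z, F z = inner ℝ a z + b
  eigenvalue_le : ∃ H : EuclideanSpace ℝ (Fin N) → Matrix (Fin N) (Fin N) ℝ,
    HasWeakDeriv Set.univ (∇ F) H ∧ ∀ᵐ z, lamMax (H z) ≤ K * lamMin (H z)

/-- The (classical) divergence `∑ᵢ ∂ᵢ Vⁱ(x)` of a vector field differentiable at `x`. -/
def divergence {N : ℕ} (V : EuclideanSpace ℝ (Fin N) → EuclideanSpace ℝ (Fin N))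
    (x : EuclideanSpace ℝ (Fin N)) : ℝ :=
  ∑ i, fderiv ℝ V x (EuclideanSpace.single i 1) i

/-- The stress field `V(x) = DF(Du(x))`. -/
def stressField {N : ℕ} (F u : EuclideanSpace ℝ (Fin N) → ℝ) :
    EuclideanSpace ℝ (Fin N) → EuclideanSpace ℝ (Fin N) :=
  fun x => ∇ F (∇ u x)

end

/-! ### Linear algebra: products of two symmetric matrices. -/

section MatrixInequality

open Matrix

/-! By the chain rule `DV = A S` with `A = D²F(Du)` and `S = D²u`, both symmetric. In an eigenbasis
of `A`, `|AS|² = ∑ aᵢ² sᵢⱼ²` and `tr((AS)²) = ∑ aᵢ aⱼ sᵢⱼ²`, so comparable eigenvalues give the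
pointwise bound `|DV|² ≤ K tr((DV)²)` (`sum_sq_mul_le_trace_of_lamMax_le`).

Moreover `tr((DV)²) - (tr DV)²` is a null Lagrangian, and `tr DV = f`. Testing with `η^(2k+2)` and
absorbing the gradient terms by Young's inequality gives a Caccioppoli inequality
(`integral_cutoff_mul_sum_sq_jacobian_le`): with `X = ∫ η^(2k+2) |DV|²`, `Y = ∫ η^(2k) |V|²` and `Z
= ∫ η^(2k+2) f²`, one has `X ≤ 2KZ + bY`.

To replace `L²` by `L^θ` on the right, `Y` is interpolated between the `L^q` norm of `η^(k+1) V` and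
the `L^θ` norm of `V` (`lintegral_cutoff_sq_le_add`). Sobolev's inequality bounds the former by `X`
and `Y`, with a coefficient as small as desired, so everything is absorbed in a single step.
Choosing that coefficient small relative to `b` keeps the factor of `Z` equal to `8K`: the radius
enters only the constant in front of the `L^θ` norm. -/

lemma sum_sq_entries_eq_trace {n : ℕ} (M : Matrix (Fin n) (Fin n) ℝ) :
    ∑ i, ∑ j, M i j ^ 2 = (M * Mᵀ).trace := by
  simp [Matrix.trace, Matrix.mul_apply, sq]

/-- Entrywise this is `aᵢ² ≤ K aᵢ aⱼ`. It is immediate for `aᵢ ≥ 0`; if `aᵢ < 0`, then `aᵢ ≤ K aᵢ`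
forces `K = 1`, and all the `aⱼ` coincide. -/
lemma sum_sq_diagonal_mul_le {n : ℕ} {K : ℝ} (hK : 1 ≤ K) (a : Fin n → ℝ)
    (ha : ∀ i j, a i ≤ K * a j) {S : Matrix (Fin n) (Fin n) ℝ} (hS : Sᵀ = S) :
    ∑ i, ∑ j, (diagonal a * S) i j ^ 2 ≤
      K * (diagonal a * S * (diagonal a * S)).trace := by
  have hs : ∀ i j, S j i = S i j := fun i j => congrFun (congrFun hS i) j
  simp only [Matrix.trace, Matrix.diag, Matrix.mul_apply (M := diagonal a * S), diagonal_mul,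
    Finset.mul_sum]
  refine Finset.sum_le_sum fun i _ => Finset.sum_le_sum fun j _ => ?_
  rw [hs i j]
  have key : a i ^ 2 ≤ K * (a i * a j) := by
    rcases le_or_gt 0 (a i) with h | h
    · nlinarith [ha i j]
    · have hK1 : K = 1 := by
        have := ha i i
        nlinarith
      subst hK1
      have h1 := ha i j
      have h2 := ha j i
      have : a i = a j := by linarith
      rw [this]; nlinarith
  nlinarith [mul_le_mul_of_nonneg_right key (sq_nonneg (S i j))]

/-- If the eigenvalues of the symmetric matrix `A` are comparable with ratio `K`, then
`|AS|² ≤ K tr((AS)²)` for every symmetric matrix `S`. -/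
theorem sum_sq_mul_le_trace_of_lamMax_le {n : ℕ} {K : ℝ} (hK : 1 ≤ K)
    {A S : Matrix (Fin n) (Fin n) ℝ} (hA : Aᵀ = A) (hS : Sᵀ = S)
    (h : lamMax A ≤ K * lamMin A) :
    ∑ i, ∑ j, (A * S) i j ^ 2 ≤ K * (A * S * (A * S)).trace := by
  have hH : A.IsHermitian := by
    rw [Matrix.IsHermitian, conjTranspose_eq_transpose_of_trivial, hA]
  have hfin : (spectrum ℝ A).Finite := A.finite_real_spectrum
  have ha : ∀ i j, hH.eigenvalues i ≤ K * hH.eigenvalues j := fun i j =>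
    calc hH.eigenvalues i ≤ lamMax A :=
          le_csSup hfin.bddAbove (hH.eigenvalues_mem_spectrum_real i)
      _ ≤ K * lamMin A := h
      _ ≤ K * hH.eigenvalues j := by
          gcongr
          exact csInf_le hfin.bddBelow (hH.eigenvalues_mem_spectrum_real j)
  set U : Matrix (Fin n) (Fin n) ℝ := (hH.eigenvectorUnitary).1 with hU
  have hUU : Uᵀ * U = 1 := by
    have := Matrix.mem_unitaryGroup_iff'.1 hH.eigenvectorUnitary.2
    rwa [star_eq_conjTranspose, conjTranspose_eq_transpose_of_trivial] at this
  have hUU' : U * Uᵀ = 1 := by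
    have := Matrix.mem_unitaryGroup_iff.1 hH.eigenvectorUnitary.2
    rwa [star_eq_conjTranspose, conjTranspose_eq_transpose_of_trivial] at this
  have hspec : A = U * diagonal hH.eigenvalues * Uᵀ := by
    have := hH.spectral_theorem
    rw [Unitary.conjStarAlgAut_apply] at this
    rw [← conjTranspose_eq_transpose_of_trivial, ← star_eq_conjTranspose]
    exact this
  set D := diagonal hH.eigenvalues
  have hS' : (Uᵀ * S * U)ᵀ = Uᵀ * S * U := by
    simp [Matrix.transpose_mul, hS, Matrix.mul_assoc]
  -- In the eigenbasis of `A` the factor `S` becomes `Uᵀ S U`, still symmetric, and orthogonal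
  -- conjugation preserves both traces; this reduces the claim to diagonal `A`.
  have hAS : A * S = U * (D * (Uᵀ * S * U)) * Uᵀ := by
    calc A * S = U * D * Uᵀ * S := by rw [← hspec]
      _ = U * D * Uᵀ * S * (U * Uᵀ) := by rw [hUU', Matrix.mul_one]
      _ = _ := by simp only [Matrix.mul_assoc]
  have main := sum_sq_diagonal_mul_le hK hH.eigenvalues ha hS'
  rw [sum_sq_entries_eq_trace] at main ⊢
  set M := D * (Uᵀ * S * U)
  have conj (P : Matrix (Fin n) (Fin n) ℝ) : (U * P * Uᵀ).trace = P.trace := by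
    rw [Matrix.trace_mul_comm, ← Matrix.mul_assoc, hUU, Matrix.one_mul]
  have h1 : A * S * (A * S)ᵀ = U * (M * Mᵀ) * Uᵀ := by
    rw [hAS]
    calc U * M * Uᵀ * (U * M * Uᵀ)ᵀ = U * M * (Uᵀ * U) * Mᵀ * Uᵀ := by
          simp only [Matrix.transpose_mul, Matrix.transpose_transpose, Matrix.mul_assoc]
      _ = _ := by rw [hUU]; simp only [Matrix.mul_assoc, Matrix.one_mul]
  have h2 : A * S * (A * S) = U * (M * M) * Uᵀ := by
    rw [hAS]
    calc U * M * Uᵀ * (U * M * Uᵀ) = U * M * (Uᵀ * U) * M * Uᵀ := by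
          simp only [Matrix.mul_assoc]
      _ = _ := by rw [hUU]; simp only [Matrix.mul_assoc, Matrix.one_mul]
  rw [h1, h2, conj, conj]
  exact main

end MatrixInequality

/-! ### Weak symmetry of mixed derivatives for `C¹` functions. -/

section IntegrationByParts

variable {E : Type*} [NormedAddCommGroup E] [NormedSpace ℝ E] [MeasurableSpace E] [BorelSpace E]
  [FiniteDimensional ℝ E] {μ : Measure E} [μ.IsAddHaarMeasure]

open Convolution in
/-- Mixed second derivatives commute in the weak sense: `∫ ∂ᵤw ∂ᵥb = ∫ ∂ᵥw ∂ᵤb`. -/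
theorem integral_fderiv_mul_fderiv_comm {w b : E → ℝ} (hw : ContDiff ℝ 1 w)
    (hwc : HasCompactSupport w) (hb : ContDiff ℝ 1 b) (hbc : HasCompactSupport b) (u v : E) :
    ∫ x, fderiv ℝ w x u * fderiv ℝ b x v ∂μ = ∫ x, fderiv ℝ w x v * fderiv ℝ b x u ∂μ := by
  -- The convolution of the reflected function `w'` with `b` is twice differentiable, one derivative
  -- falling on each factor. Symmetry of its second derivative at `0` is the claim, so no second
  -- derivative of `w` or `b` is needed.
  set w' : E → ℝ := fun t => w (-t) with hw'
  have hw'd : ContDiff ℝ 1 w' := hw.comp contDiff_neg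
  have hw'c : HasCompactSupport w' := hwc.comp_homeomorph (Homeomorph.neg E)
  have hfd : ∀ t u, fderiv ℝ w' t u = - fderiv ℝ w (-t) u := by
    intro t u
    have := ((hw.differentiable one_ne_zero (-t)).hasFDerivAt.comp t
      (hasFDerivAt_id t).neg).fderiv
    have h2 : fderiv ℝ w' t = _ := this
    rw [h2]; simp
  set L := ContinuousLinearMap.mul ℝ ℝ
  have hbf : Continuous (fderiv ℝ b) := hb.continuous_fderiv one_ne_zero
  have hw'f : Continuous (fderiv ℝ w') := hw'd.continuous_fderiv one_ne_zero
  have h1 := fun x => hbc.hasFDerivAt_convolution_right L (μ := μ)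
    (hw'd.continuous.locallyIntegrable) hb x
  have h2 := hw'c.hasFDerivAt_convolution_left (L.precompR E) (μ := μ) hw'd
    hbf.locallyIntegrable 0
  have hsymm := second_derivative_symmetric h1 h2
  have key : ∀ u v : E, (convolution (𝕜 := ℝ) (F := E →L[ℝ] E →L[ℝ] ℝ) (fderiv ℝ w')
      (fderiv ℝ b) ((L.precompR E).precompL E) μ 0) u v = - ∫ x, fderiv ℝ w x u * fderiv ℝ b x v ∂μ := by
    intro u v
    have hex : ConvolutionExistsAt (𝕜 := ℝ) (F := E →L[ℝ] E →L[ℝ] ℝ) (fderiv ℝ w') (fderiv ℝ b) 0 ((L.precompR E).precompL E) μ :=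
      (hbc.fderiv ℝ).convolutionExists_right _ hw'f.locallyIntegrable hbf 0
    rw [convolution_def, ContinuousLinearMap.integral_apply hex,
      ContinuousLinearMap.integral_apply]
    swap
    · exact hex.apply_continuousLinearMap u
    rw [← integral_neg, ← integral_neg_eq_self]
    refine integral_congr_ae (Filter.Eventually.of_forall fun t => ?_)
    simp [ContinuousLinearMap.precompL_apply, ContinuousLinearMap.precompR_apply, hfd, L]
  have := hsymm u v
  rw [key, key] at this
  linarith

end IntegrationByParts

/-! ### Jacobians, weak derivatives, and the pointwise inequality for the stress field. -/

noncomputable section Jacobian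

/-- The Jacobian matrix `(∂ⱼ Vⁱ(x))ᵢⱼ` of a vector field. -/
def jacobian {N : ℕ} (V : EuclideanSpace ℝ (Fin N) → EuclideanSpace ℝ (Fin N))
    (x : EuclideanSpace ℝ (Fin N)) : Matrix (Fin N) (Fin N) ℝ :=
  Matrix.of fun i j => fderiv ℝ V x (EuclideanSpace.single j 1) i

variable {N : ℕ} {V W : EuclideanSpace ℝ (Fin N) → EuclideanSpace ℝ (Fin N)}
  {F u : EuclideanSpace ℝ (Fin N) → ℝ} {x : EuclideanSpace ℝ (Fin N)}
  {Ω : Set (EuclideanSpace ℝ (Fin N))}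

lemma jacobian_apply (V : EuclideanSpace ℝ (Fin N) → EuclideanSpace ℝ (Fin N))
    (x : EuclideanSpace ℝ (Fin N)) (i j : Fin N) :
    jacobian V x i j = fderiv ℝ V x (EuclideanSpace.single j 1) i := rfl

lemma jacobian_apply_eq_fderiv (hV : DifferentiableAt ℝ V x) (i j : Fin N) :
    jacobian V x i j = fderiv ℝ (fun y => V y i) x (EuclideanSpace.single j 1) := by
  have h := ((EuclideanSpace.proj i : EuclideanSpace ℝ (Fin N) →L[ℝ] ℝ).hasFDerivAt.comp x
    hV.hasFDerivAt).fderiv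
  have h2 : fderiv ℝ (fun y => V y i) x = _ := h
  rw [h2, jacobian_apply]
  simp

lemma continuousOn_jacobian (hΩ : IsOpen Ω) (hV : ContDiffOn ℝ 1 V Ω) (i j : Fin N) :
    ContinuousOn (fun x => jacobian V x i j) Ω := by
  have h := hV.continuousOn_fderiv_of_isOpen hΩ le_rfl
  have h2 : ContinuousOn (fun x => fderiv ℝ V x (EuclideanSpace.single j 1)) Ω :=
    h.clm_apply continuousOn_const
  exact (EuclideanSpace.proj i : EuclideanSpace ℝ (Fin N) →L[ℝ] ℝ).continuous.comp_continuousOn h2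

lemma continuous_jacobian (hV : ContDiff ℝ 1 V) (i j : Fin N) :
    Continuous (fun x => jacobian V x i j) := by
  rw [← continuousOn_univ]
  exact continuousOn_jacobian isOpen_univ hV.contDiffOn i j

lemma jacobian_comp (hV : DifferentiableAt ℝ V (W x)) (hW : DifferentiableAt ℝ W x) :
    jacobian (fun y => V (W y)) x = jacobian V (W x) * jacobian W x := by
  ext i j
  have h : fderiv ℝ (fun y => V (W y)) x = _ := fderiv_comp x hV hW
  rw [jacobian_apply, h, Matrix.mul_apply]
  have hw := (EuclideanSpace.basisFun (Fin N) ℝ).sum_repr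
    (fderiv ℝ W x (EuclideanSpace.single j 1))
  simp only [EuclideanSpace.basisFun_repr, EuclideanSpace.basisFun_apply] at hw
  rw [ContinuousLinearMap.comp_apply]
  conv_lhs => rw [← hw]
  simp [jacobian_apply, map_sum, mul_comm]

lemma gradient_apply (u : EuclideanSpace ℝ (Fin N) → ℝ) (y : EuclideanSpace ℝ (Fin N))
    (i : Fin N) : (∇ u y) i = fderiv ℝ u y (EuclideanSpace.single i 1) := by
  have h : inner ℝ (∇ u y) (EuclideanSpace.single i (1 : ℝ)) =
      fderiv ℝ u y (EuclideanSpace.single i 1) := by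
    rw [gradient, InnerProductSpace.toDual_symm_apply]
  rw [← h, EuclideanSpace.inner_single_right]
  simp

lemma contDiffAt_gradient (hu : ContDiffAt ℝ 2 u x) : ContDiffAt ℝ 1 (∇ u) x :=
  ((InnerProductSpace.toDual ℝ (EuclideanSpace ℝ (Fin N))).symm.contDiff.contDiffAt).comp x
    (hu.fderiv_right (by norm_num))

lemma transpose_jacobian_gradient (hu : ContDiffAt ℝ 2 u x) :
    (jacobian (∇ u) x).transpose = jacobian (∇ u) x := by
  have hd : DifferentiableAt ℝ (fderiv ℝ u) x :=
    (hu.fderiv_right (m := 1) (by norm_num)).differentiableAt one_ne_zero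
  have h : ∀ i j, jacobian (∇ u) x i j =
      fderiv ℝ (fderiv ℝ u) x (EuclideanSpace.single j 1) (EuclideanSpace.single i 1) := by
    intro i j
    rw [jacobian_apply_eq_fderiv ((contDiffAt_gradient hu).differentiableAt one_ne_zero)]
    simp only [gradient_apply]
    rw [fderiv_clm_apply hd (differentiableAt_const _)]
    simp
  ext i j
  rw [Matrix.transpose_apply, h, h]
  exact (hu.isSymmSndFDerivAt (by simp)) _ _

/-- Off `Ω` the factor `h` may be arbitrary, but the product vanishes near every point outside the
support of `ψ`, hence is continuous everywhere. -/
lemma integrable_mul_of_tsupport_subset {E : Type*} [NormedAddCommGroup E] [MeasurableSpace E]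
    [BorelSpace E] {μ : Measure E} [IsFiniteMeasureOnCompacts μ] {Ω : Set E} {h ψ : E → ℝ}
    (hΩ : IsOpen Ω) (hh : ContinuousOn h Ω) (hψ : Continuous ψ) (hc : HasCompactSupport ψ)
    (hs : tsupport ψ ⊆ Ω) : Integrable (fun x => h x * ψ x) μ := by
  have hsub : tsupport (fun x => h x * ψ x) ⊆ tsupport ψ := tsupport_mul_subset_right
  refine Continuous.integrable_of_hasCompactSupport ?_ (hc.mul_left)
  refine continuous_iff_continuousAt.2 fun x => ?_
  by_cases hx : x ∈ tsupport ψ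
  · exact (hh.continuousAt (hΩ.mem_nhds (hs hx))).mul hψ.continuousAt
  · have : (fun x => h x * ψ x) =ᶠ[nhds x] fun _ => 0 :=
      notMem_tsupport_iff_eventuallyEq.1 fun h' => hx (hsub h')
    exact continuousAt_const.congr this.symm

theorem hasWeakDeriv_jacobian (hΩ : IsOpen Ω) (hV : ContDiffOn ℝ 1 V Ω) :
    HasWeakDeriv Ω V (jacobian V) where
  locInt i := (((EuclideanSpace.proj i : EuclideanSpace ℝ (Fin N) →L[ℝ] ℝ).continuous
    ).comp_continuousOn hV.continuousOn).locallyIntegrableOn hΩ.measurableSet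
  locInt_deriv i j := (continuousOn_jacobian hΩ hV i j).locallyIntegrableOn hΩ.measurableSet
  integral_eq i j φ hφ hc hs := by
    have hφ1 : ContDiff ℝ 1 φ := hφ.of_le (by exact_mod_cast le_top)
    set e : EuclideanSpace ℝ (Fin N) := EuclideanSpace.single j 1
    have hVi : ContinuousOn (fun x => V x i) Ω :=
      ((EuclideanSpace.proj i : EuclideanSpace ℝ (Fin N) →L[ℝ] ℝ).continuous
        ).comp_continuousOn hV.continuousOn
    have hd : ∀ x ∈ Ω, DifferentiableAt ℝ V x := fun x hx =>
      (hV.contDiffAt (hΩ.mem_nhds hx)).differentiableAt one_ne_zero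
    have hJ : ∀ x ∈ Ω, fderiv ℝ (fun y => V y i) x e = jacobian V x i j :=
      fun x hx => (jacobian_apply_eq_fderiv (hd x hx) i j).symm
    have h0 : ∀ x, x ∉ Ω → φ x = 0 := fun x hx => image_eq_zero_of_notMem_tsupport
      fun h => hx (hs h)
    have h0' : ∀ x, x ∉ Ω → fderiv ℝ φ x e = 0 := fun x hx => by
      have : fderiv ℝ φ x = 0 := image_eq_zero_of_notMem_tsupport
        fun h => hx (hs (tsupport_fderiv_subset ℝ h))
      simp [this]
    have hi3 : Integrable (fun x => V x i * φ x) volume :=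
      integrable_mul_of_tsupport_subset hΩ hVi hφ.continuous hc hs
    have hi2 : Integrable (fun x => V x i * fderiv ℝ φ x e) volume :=
      integrable_mul_of_tsupport_subset hΩ hVi
        ((hφ1.continuous_fderiv one_ne_zero).clm_apply continuous_const)
        (hc.fderiv_apply ℝ e) ((tsupport_fderiv_apply_subset ℝ e).trans hs)
    have heq : ∀ x, fderiv ℝ (fun y => V y i) x e * φ x = jacobian V x i j * φ x := by
      intro x
      by_cases hx : x ∈ Ω
      · rw [hJ x hx]
      · simp [h0 x hx]
    have hi1 : Integrable (fun x => fderiv ℝ (fun y => V y i) x e * φ x) volume := by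
      simp only [heq]
      exact integrable_mul_of_tsupport_subset hΩ (continuousOn_jacobian hΩ hV i j)
        hφ.continuous hc hs
    have := integral_mul_fderiv_eq_neg_fderiv_mul_of_integrable hi1 hi2 hi3
      (fun x hx => by
        exact (EuclideanSpace.proj i : EuclideanSpace ℝ (Fin N) →L[ℝ] ℝ).differentiableAt.comp x
          (hd x (hs hx)))
      (fun x _ => hφ1.differentiable one_ne_zero x)
    simp only [heq] at this
    rw [setIntegral_eq_integral_of_forall_compl_eq_zero (fun x hx => by simp [h0' x hx]),
      setIntegral_eq_integral_of_forall_compl_eq_zero (fun x hx => by simp [h0 x hx]), this]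

theorem HasWeakDeriv.ae_eq_jacobian {H : EuclideanSpace ℝ (Fin N) → Matrix (Fin N) (Fin N) ℝ}
    (hH : HasWeakDeriv Set.univ V H) (hV : ContDiff ℝ 1 V) : ∀ᵐ x, H x = jacobian V x := by
  have hJ := hasWeakDeriv_jacobian isOpen_univ hV.contDiffOn
  have : ∀ i j, ∀ᵐ x, H x i j = jacobian V x i j := fun i j => by
    refine ae_eq_of_integral_contDiff_smul_eq (locallyIntegrableOn_univ.1 (hH.locInt_deriv i j))
      (locallyIntegrableOn_univ.1 (hJ.locInt_deriv i j)) fun g hg hgc => ?_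
    have h1 := hH.integral_eq i j g hg hgc (Set.subset_univ _)
    have h2 := hJ.integral_eq i j g hg hgc (Set.subset_univ _)
    rw [h1, setIntegral_univ, setIntegral_univ] at h2
    simp only [smul_eq_mul, mul_comm (g _)]
    linarith
  filter_upwards [ae_all_iff.2 fun i => ae_all_iff.2 (this i)] with x hx
  ext i j
  exact hx i j

/-- The eigenvalue bound holds for almost every `z` only, whereas `Du` may send a set of positive
measure into a null set. Since `D²F` is continuous, the inequality defines a closed set; being of
full measure it is dense, hence everything. -/
theorem IsQuasiuniformlyConvex.sum_sq_mul_le_trace {K : ℝ} (hF : IsQuasiuniformlyConvex K F)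
    (hF2 : ContDiff ℝ 2 F) (z : EuclideanSpace ℝ (Fin N)) {S : Matrix (Fin N) (Fin N) ℝ}
    (hS : S.transpose = S) :
    ∑ i, ∑ j, (jacobian (∇ F) z * S) i j ^ 2 ≤
      K * (jacobian (∇ F) z * S * (jacobian (∇ F) z * S)).trace := by
  have hg : ContDiff ℝ 1 (∇ F) := contDiff_iff_contDiffAt.2 fun x =>
    contDiffAt_gradient hF2.contDiffAt
  obtain ⟨H, hH, hle⟩ := hF.eigenvalue_le
  have hae : ∀ᵐ z, ∑ i, ∑ j, (jacobian (∇ F) z * S) i j ^ 2 ≤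
      K * (jacobian (∇ F) z * S * (jacobian (∇ F) z * S)).trace := by
    filter_upwards [hH.ae_eq_jacobian hg, hle] with z h1 h2
    rw [h1] at h2
    exact sum_sq_mul_le_trace_of_lamMax_le hF.one_le
      (transpose_jacobian_gradient hF2.contDiffAt) hS h2
  have hJ : Continuous (fun z => jacobian (∇ F) z) :=
    continuous_matrix fun i j => continuous_jacobian hg i j
  have hclosed : IsClosed {z | ∑ i, ∑ j, (jacobian (∇ F) z * S) i j ^ 2 ≤
      K * (jacobian (∇ F) z * S * (jacobian (∇ F) z * S)).trace} := by
    have hM : Continuous fun z => jacobian (∇ F) z * S := hJ.matrix_mul continuous_const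
    refine isClosed_le ?_ ?_
    · exact continuous_finsetSum _ fun i _ => continuous_finsetSum _ fun j _ =>
        (hM.matrix_elem i j).pow 2
    · exact continuous_const.mul (hM.matrix_mul hM).matrix_trace
  have hd := Measure.dense_of_ae hae
  exact Set.eq_univ_iff_forall.1 (hclosed.closure_eq.symm.trans hd.closure_eq) z

/-- The stress field is `C¹` wherever `u` is `C²`. -/
theorem contDiffAt_stressField (hF : ContDiff ℝ 2 F) (hu : ContDiffAt ℝ 2 u x) :
    ContDiffAt ℝ 1 (stressField F u) x :=
  (contDiffAt_gradient hF.contDiffAt).comp x (contDiffAt_gradient hu)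

/-- The derivative of the stress field satisfies `|DV|² ≤ K tr((DV)²)`. -/
theorem IsQuasiuniformlyConvex.sum_sq_jacobian_stressField_le {K : ℝ}
    (hF : IsQuasiuniformlyConvex K F) (hF2 : ContDiff ℝ 2 F) (hu : ContDiffAt ℝ 2 u x) :
    ∑ i, ∑ j, jacobian (stressField F u) x i j ^ 2 ≤
      K * (jacobian (stressField F u) x * jacobian (stressField F u) x).trace := by
  have h : jacobian (stressField F u) x = jacobian (∇ F) (∇ u x) * jacobian (∇ u) x :=
    jacobian_comp ((contDiffAt_gradient hF2.contDiffAt).differentiableAt one_ne_zero)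
      ((contDiffAt_gradient hu).differentiableAt one_ne_zero)
  rw [h]
  exact hF.sum_sq_mul_le_trace hF2 _ (transpose_jacobian_gradient hu)

end Jacobian

/-! ### The Caccioppoli inequality. -/

noncomputable section Caccioppoli

/-- Young's inequality for the terms where the derivative hits the cutoff, with `a = η^k`, `b =
η^(k+1)`, `g = Dη`, `J = DV`. The diagonal entries `J j j` occur once for each `i`, hence their
weight `1 / (4N)`; both kinds of term then contribute at most a quarter of `b² |J|²`. -/
lemma mul_sum_cutoff_terms_le {N : ℕ} {K c M a b : ℝ} (v g : Fin N → ℝ)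
    (J : Matrix (Fin N) (Fin N) ℝ) (hg : ∀ i, |g i| ≤ M) :
    K * ∑ i, ∑ j, v i * (c * (a * b) * g i * J j j - c * (a * b) * g j * J j i) ≤
      1 / 2 * (b ^ 2 * ∑ i, ∑ j, J i j ^ 2) +
        (N ^ 2 + N) * K ^ 2 * c ^ 2 * M ^ 2 * (a ^ 2 * ∑ i, v i ^ 2) := by
  rcases Nat.eq_zero_or_pos N with rfl | hN
  · simp
  have hN' : (0 : ℝ) < N := by exact_mod_cast hN
  have hg2 : ∀ i, g i ^ 2 ≤ M ^ 2 := fun i => sq_le_sq' (by linarith [abs_le.1 (hg i)])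
    (abs_le.1 (hg i)).2
  have h1 : ∀ i j, K * (v i * (c * (a * b) * g i * J j j - c * (a * b) * g j * J j i)) ≤
      b ^ 2 * J j j ^ 2 / (4 * N) + b ^ 2 * J j i ^ 2 / 4 +
        (N + 1) * (K ^ 2 * c ^ 2 * M ^ 2 * (a ^ 2 * v i ^ 2)) := by
    intro i j
    have e1 : K * (v i * (c * (a * b) * g i * J j j)) ≤
        b ^ 2 * J j j ^ 2 / (4 * N) + N * (K ^ 2 * c ^ 2 * g i ^ 2 * (a ^ 2 * v i ^ 2)) := by
      have : 0 ≤ (b * J j j - 2 * N * (K * c * g i * (a * v i))) ^ 2 / (4 * N) := by positivity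
      have e : (b * J j j - 2 * N * (K * c * g i * (a * v i))) ^ 2 / (4 * N) =
          b ^ 2 * J j j ^ 2 / (4 * N) + N * (K ^ 2 * c ^ 2 * g i ^ 2 * (a ^ 2 * v i ^ 2)) -
            K * (v i * (c * (a * b) * g i * J j j)) := by
        field_simp
        ring
      linarith
    have e2 : - (K * (v i * (c * (a * b) * g j * J j i))) ≤
        b ^ 2 * J j i ^ 2 / 4 + K ^ 2 * c ^ 2 * g j ^ 2 * (a ^ 2 * v i ^ 2) := by
      nlinarith [sq_nonneg (b * J j i / 2 + K * c * g j * (a * v i))]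
    have e3 : ∀ i', K ^ 2 * c ^ 2 * g i' ^ 2 * (a ^ 2 * v i ^ 2) ≤
        K ^ 2 * c ^ 2 * M ^ 2 * (a ^ 2 * v i ^ 2) := fun i' => by
      exact mul_le_mul_of_nonneg_right (mul_le_mul_of_nonneg_left (hg2 i') (by positivity))
        (by positivity)
    have e4 := mul_le_mul_of_nonneg_left (e3 i) hN'.le
    linarith [e3 j]
  have hdiag : ∑ j, J j j ^ 2 ≤ ∑ i, ∑ j, J i j ^ 2 := Finset.sum_le_sum fun i _ =>
    Finset.single_le_sum (f := fun j => J i j ^ 2) (fun j _ => sq_nonneg _) (Finset.mem_univ i)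
  have hcomm : ∑ i, ∑ j, J j i ^ 2 = ∑ i, ∑ j, J i j ^ 2 := Finset.sum_comm
  calc K * ∑ i, ∑ j, v i * (c * (a * b) * g i * J j j - c * (a * b) * g j * J j i)
      ≤ ∑ i, ∑ j, (b ^ 2 * J j j ^ 2 / (4 * N) + b ^ 2 * J j i ^ 2 / 4 +
        (N + 1) * (K ^ 2 * c ^ 2 * M ^ 2 * (a ^ 2 * v i ^ 2))) := by
        rw [Finset.mul_sum]
        simp_rw [Finset.mul_sum]
        exact Finset.sum_le_sum fun i _ => Finset.sum_le_sum fun j _ => h1 i j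
    _ = b ^ 2 / 4 * (∑ j, J j j ^ 2) + b ^ 2 / 4 * (∑ i, ∑ j, J j i ^ 2) +
        N * ((N + 1) * (K ^ 2 * c ^ 2 * M ^ 2 * (a ^ 2 * ∑ i, v i ^ 2))) := by
        simp only [Finset.sum_add_distrib, Finset.sum_const, Finset.card_univ, Fintype.card_fin,
          nsmul_eq_mul, Finset.mul_sum]
        congr 2
        · refine Finset.sum_congr rfl fun j _ => ?_
          field_simp
        · exact Finset.sum_congr rfl fun i _ => Finset.sum_congr rfl fun j _ => by ring
    _ ≤ _ := by
        rw [hcomm]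
        have := mul_le_mul_of_nonneg_left hdiag (by positivity : 0 ≤ b ^ 2 / 4)
        nlinarith

variable {N : ℕ} {V : EuclideanSpace ℝ (Fin N) → EuclideanSpace ℝ (Fin N)}

/-- The difference `tr((DV)²) - (tr DV)²` is a divergence. -/
lemma integral_null_lagrangian {φ : EuclideanSpace ℝ (Fin N) → ℝ} (hV : ContDiff ℝ 1 V)
    (hVc : HasCompactSupport V) (hφ : ContDiff ℝ 1 φ) (i j : Fin N) :
    ∫ x, (φ x * (jacobian V x i j * jacobian V x j i) - φ x * (jacobian V x i i * jacobian V x j j)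
      - V x i * (fderiv ℝ φ x (EuclideanSpace.single i 1) * jacobian V x j j
        - fderiv ℝ φ x (EuclideanSpace.single j 1) * jacobian V x j i)) = 0 := by
  have hVi : ∀ i, ContDiff ℝ 1 fun x => V x i := fun i =>
    (EuclideanSpace.proj i : EuclideanSpace ℝ (Fin N) →L[ℝ] ℝ).contDiff.comp hV
  have hVic : ∀ i, HasCompactSupport fun x => V x i := fun i =>
    hVc.comp_left (g := fun y : EuclideanSpace ℝ (Fin N) => y i) rfl
  have hJ : ∀ x i j, jacobian V x i j = fderiv ℝ (fun y => V y i) x (EuclideanSpace.single j 1) :=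
    fun x => jacobian_apply_eq_fderiv (hV.differentiable one_ne_zero x)
  have hw : ContDiff ℝ 1 fun x => φ x * V x i := hφ.mul (hVi i)
  have hwc : HasCompactSupport fun x => φ x * V x i := (hVic i).mul_left
  have hfw : ∀ x k, fderiv ℝ (fun x => φ x * V x i) x (EuclideanSpace.single k 1) =
      φ x * jacobian V x i k + V x i * fderiv ℝ φ x (EuclideanSpace.single k 1) := by
    intro x k
    rw [fderiv_fun_mul (hφ.differentiable one_ne_zero x) ((hVi i).differentiable one_ne_zero x),
      hJ]
    simp
  have hcont : ∀ k l m, Continuous fun x =>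
      fderiv ℝ (fun x => φ x * V x i) x (EuclideanSpace.single k 1) * jacobian V x l m :=
    fun k l m => ((hw.continuous_fderiv one_ne_zero).clm_apply continuous_const).mul
      (continuous_jacobian hV l m)
  have hint : ∀ k l m, Integrable (fun x =>
      fderiv ℝ (fun x => φ x * V x i) x (EuclideanSpace.single k 1) * jacobian V x l m) volume :=
    fun k l m => (hcont k l m).integrable_of_hasCompactSupport
      (hwc.fderiv_apply ℝ _).mul_right
  -- Weak symmetry with `w = φ Vᵢ` and `b = Vⱼ`; the product rule on `w` produces the two quadratic
  -- terms and the two terms with `Dφ`.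
  have key := integral_fderiv_mul_fderiv_comm (μ := volume) hw hwc (hVi j) (hVic j)
    (EuclideanSpace.single j 1) (EuclideanSpace.single i 1)
  simp only [← hJ] at key
  rw [← sub_eq_zero, ← integral_sub (hint j j i) (hint i j j)] at key
  rw [← key]
  refine integral_congr_ae (Filter.Eventually.of_forall fun x => ?_)
  simp only [hfw]
  ring

/-- Caccioppoli inequality for fields with `|DV|² ≤ K tr((DV)²)`. -/
theorem integral_cutoff_mul_sum_sq_jacobian_le {K M : ℝ} (k : ℕ)
    (hV : ContDiff ℝ 1 V)
    (hVc : HasCompactSupport V) {η : EuclideanSpace ℝ (Fin N) → ℝ} (hη : ContDiff ℝ 1 η)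
    (hM : ∀ x i, |fderiv ℝ η x (EuclideanSpace.single i 1)| ≤ M)
    (h : ∀ x, η x ≠ 0 →
      ∑ i, ∑ j, jacobian V x i j ^ 2 ≤ K * (jacobian V x * jacobian V x).trace) :
    ∫ x, (η x ^ (k + 1)) ^ 2 * ∑ i, ∑ j, jacobian V x i j ^ 2 ≤
      2 * K * (∫ x, (η x ^ (k + 1)) ^ 2 * (jacobian V x).trace ^ 2) +
        2 * ((N ^ 2 + N) * K ^ 2 * (2 * k + 2) ^ 2 * M ^ 2) *
          ∫ x, (η x ^ k) ^ 2 * ∑ i, V x i ^ 2 := by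
  set B : ℝ := (N ^ 2 + N) * K ^ 2 * (2 * k + 2) ^ 2 * M ^ 2
  set φ : EuclideanSpace ℝ (Fin N) → ℝ := fun x => (η x ^ (k + 1)) ^ 2
  have hφ : ContDiff ℝ 1 φ := (hη.pow _).pow _
  -- The power `η^(2k+1)` is split as `η^k · η^(k+1)`, the first factor to accompany `V` and the
  -- second `DV`.
  have hfφ : ∀ x v, fderiv ℝ φ x v = (2 * k + 2) * (η x ^ k * η x ^ (k + 1)) * fderiv ℝ η x v := by
    intro x v
    have := ((hη.differentiable one_ne_zero x).hasFDerivAt.pow (2 * (k + 1))).fderiv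
    have e : φ = fun x => η x ^ (2 * (k + 1)) := by
      funext x
      simp only [φ]
      ring
    rw [e]
    have h3 : fderiv ℝ (fun x => η x ^ (2 * (k + 1))) x = _ := this
    have h4 : 2 * (k + 1) - 1 = k + (k + 1) := by omega
    rw [h3, h4, pow_add]
    simp only [smul_apply, nsmul_eq_mul, smul_eq_mul]
    push_cast
    ring
  have hVi : ∀ i, Continuous fun x => V x i := fun i =>
    (EuclideanSpace.proj i : EuclideanSpace ℝ (Fin N) →L[ℝ] ℝ).continuous.comp hV.continuous
  have hVic : ∀ i, HasCompactSupport fun x => V x i := fun i =>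
    hVc.comp_left (g := fun y : EuclideanSpace ℝ (Fin N) => y i) rfl
  have hJ := continuous_jacobian hV
  have hJc : ∀ i j, HasCompactSupport fun x => jacobian V x i j := fun i j => by
    have := hVc.fderiv_apply ℝ (EuclideanSpace.single j (1 : ℝ))
    exact this.comp_left (g := fun y : EuclideanSpace ℝ (Fin N) => y i) rfl
  have hcφ := hφ.continuous
  have hfφc : ∀ i, Continuous fun x => fderiv ℝ φ x (EuclideanSpace.single i 1) := fun i =>
    (hφ.continuous_fderiv one_ne_zero).clm_apply continuous_const
  have hsum_cs : ∀ f : Fin N → EuclideanSpace ℝ (Fin N) → ℝ, (∀ i, HasCompactSupport (f i)) →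
      HasCompactSupport fun x => ∑ i, f i x := by
    intro f hf
    refine HasCompactSupport.intro (isCompact_iUnion fun i => (hf i).isCompact) fun x hx => ?_
    refine Finset.sum_eq_zero fun i _ => image_eq_zero_of_notMem_tsupport fun hi => ?_
    exact hx (Set.mem_iUnion.2 ⟨i, hi⟩)
  set G : Fin N → Fin N → EuclideanSpace ℝ (Fin N) → ℝ := fun i j x =>
    φ x * (jacobian V x i j * jacobian V x j i) - φ x * (jacobian V x i i * jacobian V x j j)
      - V x i * (fderiv ℝ φ x (EuclideanSpace.single i 1) * jacobian V x j j
        - fderiv ℝ φ x (EuclideanSpace.single j 1) * jacobian V x j i) with hG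
  have hGint : ∀ i j, Integrable (G i j) volume := fun i j => by
    refine Continuous.integrable_of_hasCompactSupport ?_ ?_
    · have := hVi i
      have := hJ i j; have := hJ j i; have := hJ i i; have := hJ j j
      have := hfφc i; have := hfφc j
      fun_prop
    · exact (((hJc i j).mul_right).mul_left.sub ((hJc i i).mul_right).mul_left).sub
        (hVic i).mul_right
  have hG0 : ∫ x, ∑ i, ∑ j, G i j x = 0 := by
    rw [integral_finsetSum _ fun i _ => integrable_finsetSum _ fun j _ => hGint i j]
    refine Finset.sum_eq_zero fun i _ => ?_
    rw [integral_finsetSum _ fun j _ => hGint i j]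
    exact Finset.sum_eq_zero fun j _ => integral_null_lagrangian hV hVc hφ i j
  have hGsum : Integrable (fun x => ∑ i, ∑ j, G i j x) volume :=
    integrable_finsetSum _ fun i _ => integrable_finsetSum _ fun j _ => hGint i j
  have hI1 : Integrable (fun x => φ x * ∑ i, ∑ j, jacobian V x i j ^ 2) volume := by
    refine Continuous.integrable_of_hasCompactSupport (by fun_prop) ?_
    refine HasCompactSupport.mul_left (hsum_cs _ fun i => hsum_cs _ fun j => ?_)
    exact (hJc i j).comp_left (g := fun y => y ^ 2) (by simp)
  have hI2 : Integrable (fun x => φ x * (jacobian V x).trace ^ 2) volume := by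
    simp only [Matrix.trace, Matrix.diag]
    refine Continuous.integrable_of_hasCompactSupport (by fun_prop) ?_
    refine HasCompactSupport.mul_left ?_
    exact (hsum_cs (fun i x => jacobian V x i i) fun i => hJc i i).comp_left
      (g := fun y => y ^ 2) (by simp)
  have hI3 : Integrable (fun x => (η x ^ k) ^ 2 * ∑ i, V x i ^ 2) volume := by
    have := hη.continuous
    refine Continuous.integrable_of_hasCompactSupport (by fun_prop) ?_
    refine HasCompactSupport.mul_left (hsum_cs _ fun i => ?_)
    exact (hVic i).comp_left (g := fun y => y ^ 2) (by simp)
  have hpt : ∀ x, φ x * ∑ i, ∑ j, jacobian V x i j ^ 2 ≤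
      2 * (K * (φ x * (jacobian V x).trace ^ 2) + B * ((η x ^ k) ^ 2 * ∑ i, V x i ^ 2) +
        K * ∑ i, ∑ j, G i j x) := by
    intro x
    have h1 : φ x * ∑ i, ∑ j, jacobian V x i j ^ 2 ≤
        K * (φ x * (jacobian V x * jacobian V x).trace) := by
      by_cases hx : η x = 0
      · simp [φ, hx]
      · calc _ ≤ φ x * (K * (jacobian V x * jacobian V x).trace) :=
              mul_le_mul_of_nonneg_left (h x hx) (sq_nonneg _)
          _ = _ := by ring
    have h2 := mul_sum_cutoff_terms_le (K := K) (c := 2 * k + 2) (a := η x ^ k)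
      (b := η x ^ (k + 1)) (V x) (fun i => fderiv ℝ η x (EuclideanSpace.single i 1))
      (jacobian V x) (hM x)
    have h3 : ∑ i, ∑ j, G i j x = φ x * (jacobian V x * jacobian V x).trace -
        φ x * (jacobian V x).trace ^ 2 - ∑ i, ∑ j, V x i *
          ((2 * k + 2) * (η x ^ k * η x ^ (k + 1)) * fderiv ℝ η x (EuclideanSpace.single i 1) *
            jacobian V x j j -
          (2 * k + 2) * (η x ^ k * η x ^ (k + 1)) * fderiv ℝ η x (EuclideanSpace.single j 1) *
            jacobian V x j i) := by
      have htr : (jacobian V x).trace ^ 2 = ∑ i, ∑ j, jacobian V x i i * jacobian V x j j := by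
        rw [sq, Matrix.trace, Finset.sum_mul_sum]
        rfl
      rw [htr]
      simp only [hG, hfφ, Finset.sum_sub_distrib, Matrix.trace, Matrix.diag, Matrix.mul_apply,
        Finset.mul_sum]
    have h4 : φ x = (η x ^ (k + 1)) ^ 2 := rfl
    rw [h3, mul_sub, mul_sub]
    rw [← h4] at h2
    linarith
  have hA : Integrable (fun x => K * (φ x * (jacobian V x).trace ^ 2) +
      B * ((η x ^ k) ^ 2 * ∑ i, V x i ^ 2)) volume := (hI2.const_mul K).add (hI3.const_mul B)
  have hA' : Integrable (fun x => K * (φ x * (jacobian V x).trace ^ 2) +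
      B * ((η x ^ k) ^ 2 * ∑ i, V x i ^ 2) + K * ∑ i, ∑ j, G i j x) volume :=
    hA.add (hGsum.const_mul K)
  have hmono := integral_mono hI1 (hA'.const_mul 2) hpt
  have hcalc : ∫ x, 2 * (K * (φ x * (jacobian V x).trace ^ 2) +
      B * ((η x ^ k) ^ 2 * ∑ i, V x i ^ 2) + K * ∑ i, ∑ j, G i j x) =
      2 * (K * (∫ x, φ x * (jacobian V x).trace ^ 2) +
        B * (∫ x, (η x ^ k) ^ 2 * ∑ i, V x i ^ 2) + K * ∫ x, ∑ i, ∑ j, G i j x) := by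
    rw [integral_const_mul, integral_add hA (hGsum.const_mul K), integral_add (hI2.const_mul K) (hI3.const_mul B),
      integral_const_mul, integral_const_mul, integral_const_mul]
  have hmono' := hmono.trans_eq hcalc
  rw [hG0] at hmono'
  refine hmono'.trans_eq ?_
  ring

end Caccioppoli

/-! ### Sobolev and interpolation inequalities. -/

noncomputable section Sobolev

lemma ofReal_sum_sq_eq_enorm_sq {N : ℕ} (v : EuclideanSpace ℝ (Fin N)) :
    ENNReal.ofReal (∑ i, v i ^ 2) = ‖v‖ₑ ^ 2 := by
  rw [← ofReal_norm, ← ENNReal.ofReal_pow (norm_nonneg _), EuclideanSpace.real_norm_sq_eq]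

lemma norm_sq_le_sum_sq_apply_single {N : ℕ} (L : EuclideanSpace ℝ (Fin N) →L[ℝ] ℝ) :
    ‖L‖ ^ 2 ≤ ∑ j, L (EuclideanSpace.single j 1) ^ 2 := by
  have h0 : 0 ≤ ∑ j, L (EuclideanSpace.single j 1) ^ 2 := Finset.sum_nonneg fun _ _ => sq_nonneg _
  have h : ‖L‖ ≤ Real.sqrt (∑ j, L (EuclideanSpace.single j 1) ^ 2) := by
    refine L.opNorm_le_bound (Real.sqrt_nonneg _) fun v => ?_
    have hv := (EuclideanSpace.basisFun (Fin N) ℝ).sum_repr v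
    simp only [EuclideanSpace.basisFun_repr, EuclideanSpace.basisFun_apply] at hv
    have hL : L v = ∑ j, L (EuclideanSpace.single j 1) * v j := by
      conv_lhs => rw [← hv]
      simp [map_sum, mul_comm]
    rw [hL, Real.norm_eq_abs, EuclideanSpace.norm_eq, ← Real.sqrt_mul h0]
    refine Real.abs_le_sqrt ?_
    simpa using Finset.sum_mul_sq_le_sq_mul_sq Finset.univ
      (fun j => L (EuclideanSpace.single j 1)) v
  calc ‖L‖ ^ 2 ≤ Real.sqrt (∑ j, L (EuclideanSpace.single j 1) ^ 2) ^ 2 := by gcongr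
    _ = _ := Real.sq_sqrt h0

lemma eLpNorm_two_sq {α ε : Type*} [MeasurableSpace α] [ENorm ε] {μ : Measure α} (f : α → ε) :
    eLpNorm f 2 μ ^ 2 = ∫⁻ x, ‖f x‖ₑ ^ 2 ∂μ := by
  have := eLpNorm_nnreal_pow_eq_lintegral (f := f) (μ := μ) (p := 2) (by norm_num)
  simpa using this

/-- The fundamental theorem of calculus on the line; it takes the place of the
Gagliardo–Nirenberg–Sobolev inequality when `N = 1`. -/
lemma enorm_le_lintegral_enorm_fderiv {w : EuclideanSpace ℝ (Fin 1) → ℝ} (hw : ContDiff ℝ 1 w)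
    (hwc : HasCompactSupport w) (x : EuclideanSpace ℝ (Fin 1)) :
    ‖w x‖ₑ ≤ ∫⁻ y, ‖fderiv ℝ w y‖ₑ := by
  let e : ℝ ≃ₗᵢ[ℝ] EuclideanSpace ℝ (Fin 1) := (OrthonormalBasis.singleton (Fin 1) ℝ).repr
  have hg : ContDiff ℝ 1 (w ∘ e) := hw.comp e.contDiff
  have hgc : HasCompactSupport (w ∘ e) := hwc.comp_homeomorph e.toHomeomorph
  have h := HasCompactSupport.enorm_le_lintegral_Ici_deriv hg hgc (e.symm x)
  have hd : ∀ t, ‖deriv (w ∘ e) t‖ₑ ≤ ‖fderiv ℝ w (e t)‖ₑ := by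
    intro t
    have h1 : HasDerivAt (w ∘ e) (fderiv ℝ w (e t) (e 1)) t := by
      have := ((hw.differentiable one_ne_zero (e t)).hasFDerivAt.comp t
        e.toContinuousLinearEquiv.hasFDerivAt).hasDerivAt
      simpa using this
    rw [h1.deriv, enorm_le_iff_norm_le]
    refine ((fderiv ℝ w (e t)).le_opNorm _).trans ?_
    simp
  calc ‖w x‖ₑ = ‖(w ∘ e) (e.symm x)‖ₑ := by simp
    _ ≤ ∫⁻ t in Set.Iic (e.symm x), ‖deriv (w ∘ e) t‖ₑ := h
    _ ≤ ∫⁻ t, ‖deriv (w ∘ e) t‖ₑ := setLIntegral_le_lintegral _ _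
    _ ≤ ∫⁻ t, ‖fderiv ℝ w (e t)‖ₑ := lintegral_mono hd
    _ = ∫⁻ y, ‖fderiv ℝ w y‖ₑ :=
      e.measurePreserving.lintegral_comp_emb e.toHomeomorph.measurableEmbedding
        fun y => ‖fderiv ℝ w y‖ₑ

/-- A Sobolev inequality for functions supported in a ball, uniform in the centre. -/
theorem exists_eLpNorm_le_mul_eLpNorm_fderiv_two {N : ℕ} (hN : 0 < N) {q : ℝ≥0} (hq : 2 ≤ q)
    (hqN : 1 / 2 - 1 / (2 * (N : ℝ)) ≤ 1 / (q : ℝ)) (r : ℝ) :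
    ∃ S : ℝ≥0, ∀ (x₀ : EuclideanSpace ℝ (Fin N)) (w : EuclideanSpace ℝ (Fin N) → ℝ),
      ContDiff ℝ 1 w → HasCompactSupport w → tsupport w ⊆ Metric.ball x₀ r →
        eLpNorm w q volume ≤ S * eLpNorm (fderiv ℝ w) 2 volume := by
  have hfin : volume (Metric.ball (0 : EuclideanSpace ℝ (Fin N)) r) ≠ ⊤ :=
    measure_ball_lt_top.ne
  have hq0 : (0 : ℝ) < q := lt_of_lt_of_le (by norm_num) (NNReal.coe_le_coe.2 hq)
  have hq2 : 1 / (q : ℝ) ≤ 1 / 2 := one_div_le_one_div_of_le (by norm_num) (by exact_mod_cast hq)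
  -- Hölder on the ball; the constant is a power of its volume and so does not depend on the centre.
  have holder : ∀ p : ℝ≥0, 1 ≤ p → p ≤ 2 → ∃ S : ℝ≥0, ∀ (x₀ : EuclideanSpace ℝ (Fin N))
      (w : EuclideanSpace ℝ (Fin N) → ℝ), ContDiff ℝ 1 w → tsupport w ⊆ Metric.ball x₀ r →
        eLpNorm (fderiv ℝ w) p volume ≤ S * eLpNorm (fderiv ℝ w) 2 volume := by
    intro p hp1 hp2
    have hp0 : (0 : ℝ) < p := lt_of_lt_of_le one_pos (NNReal.coe_le_coe.2 hp1)
    have hexp : 0 ≤ 1 / (p : ℝ) - 1 / 2 :=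
      sub_nonneg.2 (one_div_le_one_div_of_le hp0 (by exact_mod_cast hp2))
    refine ⟨(volume (Metric.ball (0 : EuclideanSpace ℝ (Fin N)) r) ^
      (1 / (p : ℝ) - 1 / 2)).toNNReal, fun x₀ w hw hs => ?_⟩
    rw [ENNReal.coe_toNNReal (ENNReal.rpow_ne_top_of_nonneg hexp hfin)]
    have hsub : Function.support (fderiv ℝ w) ⊆ Metric.ball x₀ r :=
      (support_fderiv_subset ℝ).trans hs
    have := eLpNorm_le_eLpNorm_mul_rpow_measure_univ (μ := volume.restrict (Metric.ball x₀ r))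
      (p := p) (q := 2) (f := fderiv ℝ w) (by exact_mod_cast hp2)
      (hw.continuous_fderiv one_ne_zero).aestronglyMeasurable
    have hres : ∀ p : ℝ≥0∞, eLpNorm (fderiv ℝ w) p (volume.restrict (Metric.ball x₀ r)) =
        eLpNorm (fderiv ℝ w) p volume := fun p => by
      rw [← eLpNorm_norm, ← eLpNorm_norm (fderiv ℝ w)]
      exact eLpNorm_restrict_eq_of_support_subset
        fun x hx => hsub fun h => hx (norm_eq_zero.2 h)
    rw [hres, hres, Measure.restrict_apply_univ, Measure.addHaar_ball_center, mul_comm] at this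
    simpa using this
  rcases Nat.lt_or_ge 1 N with hN2 | hN1
  · have hN2' : (2 : ℝ) ≤ N := by exact_mod_cast hN2
    have hNinv : 1 / (N : ℝ) ≤ 1 / 2 := one_div_le_one_div_of_le (by norm_num) hN2'
    have hNinv0 : 0 < 1 / (N : ℝ) := by positivity
    have hNhalf : 1 / (2 * (N : ℝ)) = 1 / 2 * (1 / N) := by field_simp
    rw [hNhalf] at hqN
    have hqpos : 0 < 1 / (q : ℝ) := by positivity
    -- The exponent whose Sobolev conjugate is `q`. `p ≥ 1` uses `q, N ≥ 2`, and `p ≤ 2` follows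
    -- from `hqN`.
    set p : ℝ≥0 := (q⁻¹ + (N : ℝ≥0)⁻¹)⁻¹ with hp
    have hpinv : (p : ℝ)⁻¹ = 1 / q + 1 / N := by simp [hp]
    have hpp : (0 : ℝ) < (p : ℝ)⁻¹ := by rw [hpinv]; positivity
    have hp0 : (0 : ℝ) < p := inv_pos.1 hpp
    have hp1 : 1 ≤ p := by
      rw [← NNReal.coe_le_coe, NNReal.coe_one, ← inv_le_inv₀ hp0 one_pos, inv_one, hpinv]
      linarith
    have hp2 : p ≤ 2 := by
      rw [← NNReal.coe_le_coe, NNReal.coe_ofNat, ← inv_le_inv₀ (by norm_num) hp0, hpinv]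
      linarith
    obtain ⟨S, hS⟩ := holder p hp1 hp2
    refine ⟨SNormLESNormFDerivOfEqConst ℝ (volume : Measure (EuclideanSpace ℝ (Fin N))) p * S,
      fun x₀ w hw hwc hs => ?_⟩
    have h1 := eLpNorm_le_eLpNorm_fderiv_of_eq (F := ℝ)
      (volume : Measure (EuclideanSpace ℝ (Fin N))) hw hwc (p := p) (p' := q) hp1
      (by simpa using hN) (by rw [NNReal.coe_inv, hpinv]; simp)
    refine h1.trans ?_
    rw [ENNReal.coe_mul, mul_assoc]
    gcongr
    exact hS x₀ w hw hs
  · obtain rfl : N = 1 := by omega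
    obtain ⟨S, hS⟩ := holder 1 le_rfl (by norm_num)
    refine ⟨(volume (Metric.ball (0 : EuclideanSpace ℝ (Fin 1)) r) ^ (q : ℝ)⁻¹).toNNReal * S,
      fun x₀ w hw hwc hs => ?_⟩
    have hsub : Function.support w ⊆ Metric.ball x₀ r := (subset_tsupport w).trans hs
    have h1 := eLpNorm_le_of_ae_enorm_bound (μ := volume.restrict (Metric.ball x₀ r)) (p := q)
      (Filter.Eventually.of_forall fun x => enorm_le_lintegral_enorm_fderiv hw hwc x)
    rw [eLpNorm_restrict_eq_of_support_subset hsub, Measure.restrict_apply_univ,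
      Measure.addHaar_ball_center, smul_eq_mul, mul_comm, ← eLpNorm_one_eq_lintegral_enorm] at h1
    rw [ENNReal.coe_mul, mul_assoc,
      ENNReal.coe_toNNReal (ENNReal.rpow_ne_top_of_nonneg (by positivity) hfin)]
    exact h1.trans (mul_le_mul' le_rfl (hS x₀ w hw hs))

/-- Interpolation of a weighted `L²` norm between `L^q` and `L^θ`. -/
theorem lintegral_cutoff_sq_le_add {α : Type*} [MeasurableSpace α] {μ : Measure α} {B : Set α}
    {k : ℕ} {θ : ℝ} {q δ : ℝ≥0} (hk : 0 < k) (hθ : 0 < θ) (hq : 0 < q)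
    (hδ : δ ≠ 0) (hexp : 2 * k / (k + 1) / (q : ℝ) + 2 / (k + 1) / θ = 1) {η v : α → ℝ}
    (hη : AEMeasurable η μ) (hv : AEMeasurable v μ) (hηB : ∀ x, x ∉ B → η x = 0) :
    ∫⁻ x, ‖η x ^ k * v x‖ₑ ^ 2 ∂μ ≤
      δ * eLpNorm (fun x => η x ^ (k + 1) * v x) q μ ^ 2 +
        (δ⁻¹) ^ k * eLpNorm v (ENNReal.ofReal θ) (μ.restrict B) ^ 2 := by
  -- `a` and `b` are Hölder exponents with sum `1`; `s` and `t` split the integrand as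
  -- `(η^(k+1)|v|)^(2s) |v|^(2t)`, where `(k+1)s = k` returns the weight `η^(2k)`.
  set a : ℝ := 2 * k / (k + 1) / (q : ℝ) with ha
  set b : ℝ := 2 / (k + 1) / θ with hb
  have ha0 : 0 ≤ a := by positivity
  have hb0 : 0 ≤ b := by positivity
  have hq' : (0 : ℝ) < q := hq
  have hkp : (0 : ℝ) < k + 1 := by positivity
  set s : ℝ := k / (k + 1) with hs
  set t : ℝ := 1 / (k + 1) with ht
  have hs0 : 0 ≤ s := by positivity
  have ht0 : 0 ≤ t := by positivity
  have hst : s + t = 1 := by rw [hs, ht]; field_simp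
  have hqa : q * a = 2 * s := by rw [ha, hs]; field_simp
  have hθb : θ * b = 2 * t := by rw [hb, ht]; field_simp
  have hpt : ∀ x, ‖η x ^ k * v x‖ₑ ^ 2 =
      (‖η x ^ (k + 1) * v x‖ₑ ^ (q : ℝ)) ^ a * (‖v x‖ₑ ^ θ) ^ b := by
    intro x
    rw [← ENNReal.rpow_mul, ← ENNReal.rpow_mul, hqa, hθb, enorm_mul, enorm_mul, enorm_pow,
      enorm_pow, ENNReal.mul_rpow_of_nonneg _ _ (by positivity), mul_assoc,
      ← ENNReal.rpow_add_of_nonneg _ _ (by positivity) (by positivity), ← mul_add, hst, mul_pow,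
      ← ENNReal.rpow_natCast_mul]
    have : ((k + 1 : ℕ) : ℝ) * (2 * s) = ((k * 2 : ℕ) : ℝ) := by
      rw [hs]; push_cast; field_simp
    rw [this, ENNReal.rpow_natCast, pow_mul]
    norm_num
  have hsupp : ∫⁻ x, ‖η x ^ k * v x‖ₑ ^ 2 ∂μ = ∫⁻ x in B, ‖η x ^ k * v x‖ₑ ^ 2 ∂μ := by
    rw [setLIntegral_eq_of_support_subset]
    intro x hx
    by_contra h
    simp [hηB x h, hk.ne'] at hx
  have hW : eLpNorm (fun x => η x ^ (k + 1) * v x) q μ ^ (q : ℝ) =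
      ∫⁻ x, ‖η x ^ (k + 1) * v x‖ₑ ^ (q : ℝ) ∂μ := eLpNorm_nnreal_pow_eq_lintegral hq.ne'
  have hT : eLpNorm v (ENNReal.ofReal θ) (μ.restrict B) ^ θ = ∫⁻ x in B, ‖v x‖ₑ ^ θ ∂μ := by
    have := eLpNorm_nnreal_pow_eq_lintegral (f := v) (μ := μ.restrict B) (p := θ.toNNReal)
      (by simpa using hθ)
    simpa [Real.coe_toNNReal _ hθ.le, ENNReal.ofReal] using this
  set A := eLpNorm (fun x => η x ^ (k + 1) * v x) q μ
  set T := eLpNorm v (ENNReal.ofReal θ) (μ.restrict B)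
  have hol : ∫⁻ x, ‖η x ^ k * v x‖ₑ ^ 2 ∂μ ≤ (A ^ 2) ^ s * (T ^ 2) ^ t := by
    calc ∫⁻ x, ‖η x ^ k * v x‖ₑ ^ 2 ∂μ
        = ∫⁻ x in B, (‖η x ^ (k + 1) * v x‖ₑ ^ (q : ℝ)) ^ a * (‖v x‖ₑ ^ θ) ^ b ∂μ := by
          rw [hsupp]; simp only [hpt]
      _ ≤ (∫⁻ x in B, ‖η x ^ (k + 1) * v x‖ₑ ^ (q : ℝ) ∂μ) ^ a *
          (∫⁻ x in B, ‖v x‖ₑ ^ θ ∂μ) ^ b := by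
          refine ENNReal.lintegral_mul_norm_pow_le ?_ ?_ ha0 hb0 hexp
          · exact (((hη.pow_const _).mul hv).enorm.pow_const _).restrict
          · exact (hv.enorm.pow_const _).restrict
      _ ≤ (A ^ (q : ℝ)) ^ a * (T ^ θ) ^ b := by
          rw [hW, hT]
          gcongr
          exact Measure.restrict_le_self
      _ = _ := by
          rw [← ENNReal.rpow_mul, ← ENNReal.rpow_mul, hqa, hθb, ENNReal.rpow_mul,
            ENNReal.rpow_mul]
          norm_num
  refine hol.trans ?_
  have hδ' : (δ : ℝ≥0∞) ≠ 0 := by simpa using hδ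
  -- Since `k t = s`, the factors `δ^s` and `(δ⁻¹)^(k t)` cancel, so the product equals `P^s Q^t ≤ P
  -- + Q`.
  set P := (δ : ℝ≥0∞) * A ^ 2
  set Q := ((δ⁻¹ : ℝ≥0) : ℝ≥0∞) ^ k * T ^ 2
  have hPQ : (A ^ 2) ^ s * (T ^ 2) ^ t = P ^ s * Q ^ t := by
    have h1 : (δ : ℝ≥0∞) ^ s * (((δ⁻¹ : ℝ≥0) : ℝ≥0∞) ^ k) ^ t = 1 := by
      rw [← ENNReal.rpow_natCast, ← ENNReal.rpow_mul]
      have : (k : ℝ) * t = s := by rw [hs, ht]; ring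
      rw [this, ← ENNReal.mul_rpow_of_nonneg _ _ hs0, ENNReal.coe_inv hδ,
        ENNReal.mul_inv_cancel hδ' ENNReal.coe_ne_top, ENNReal.one_rpow]
    rw [ENNReal.mul_rpow_of_nonneg _ _ hs0, ENNReal.mul_rpow_of_nonneg _ _ ht0]
    calc _ = 1 * ((A ^ 2) ^ s * (T ^ 2) ^ t) := by rw [one_mul]
      _ = _ := by rw [← h1]; ring
  rw [hPQ]
  calc P ^ s * Q ^ t ≤ (P + Q) ^ s * (P + Q) ^ t := by
        gcongr
        · exact le_self_add
        · exact le_add_self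
    _ = P + Q := by
      rw [← ENNReal.rpow_add_of_nonneg _ _ hs0 ht0, hst, ENNReal.rpow_one]
    _ = _ := by simp [P, Q]

end Sobolev

/-! ### The interior estimate for compactly supported `C¹` fields. -/

noncomputable section InteriorEstimate

/-- Cutoff functions between concentric balls, with a gradient bound uniform in the centre. -/
lemma exists_cutoff (N : ℕ) {r s : ℝ} (hr : 0 < r) (hrs : r < s) :
    ∃ M : ℝ, ∀ x₀ : EuclideanSpace ℝ (Fin N), ∃ η : EuclideanSpace ℝ (Fin N) → ℝ,
      ContDiff ℝ 1 η ∧ HasCompactSupport η ∧ tsupport η ⊆ Metric.ball x₀ s ∧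
      (∀ x ∈ Metric.ball x₀ r, η x = 1) ∧ (∀ x, 0 ≤ η x) ∧ (∀ x, η x ≤ 1) ∧
      ∀ x i, |fderiv ℝ η x (EuclideanSpace.single i 1)| ≤ M := by
  let f : ContDiffBump (0 : EuclideanSpace ℝ (Fin N)) := ⟨r, (r + s) / 2, hr, by linarith⟩
  have hf : ContDiff ℝ 1 f := f.contDiff
  obtain ⟨M, hM⟩ := (f.hasCompactSupport.fderiv ℝ).exists_bound_of_continuous
    (hf.continuous_fderiv one_ne_zero)
  refine ⟨M, fun x₀ => ⟨fun x => f (x - x₀), hf.comp (contDiff_id.sub contDiff_const),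
    f.hasCompactSupport.comp_homeomorph (Homeomorph.subRight x₀), ?_, ?_, fun x => f.nonneg,
    fun x => f.le_one, ?_⟩⟩
  · have h1 : tsupport (fun x => f (x - x₀)) ⊆ Metric.closedBall x₀ ((r + s) / 2) := by
      refine closure_minimal (fun x hx => ?_) Metric.isClosed_closedBall
      have : x - x₀ ∈ Function.support f := hx
      rw [f.support_eq, mem_ball_zero_iff] at this
      rw [mem_closedBall_iff_norm]
      exact this.le
    exact h1.trans (Metric.closedBall_subset_ball (by linarith))
  · intro x hx
    refine f.one_of_mem_closedBall ?_
    rw [mem_closedBall_zero_iff]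
    exact (mem_ball_iff_norm.1 hx).le
  · intro x i
    rw [fderiv_comp_sub]
    calc _ ≤ ‖fderiv ℝ f (x - x₀)‖ * ‖EuclideanSpace.single i (1 : ℝ)‖ :=
          (fderiv ℝ f (x - x₀)).le_opNorm _
      _ ≤ M := by simpa using hM (x - x₀)

/-- This `κ` makes `κ(2b + c) ≤ 1/2`, which absorbs `Y`, and `κ b ≤ 1/4`, which keeps `b` and `c`
out of the coefficient of `Z`. -/
lemma absorb_of_le_of_le {X Y Z K b c κ D : ℝ} (hb : 0 ≤ b) (hc : 0 ≤ c) (hK : 0 ≤ K) (hZ : 0 ≤ Z)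
    (hY0 : 0 ≤ Y) (hκ : κ = 1 / (2 * (2 * b + c + 1))) (hX : X ≤ 2 * K * Z + b * Y)
    (hY : Y ≤ κ * (2 * X + c * Y) + D) : X + Y ≤ 8 * K * Z + (2 * b + 2) * D := by
  have hpos : 0 < 2 * (2 * b + c + 1) := by positivity
  have hκ0 : 0 ≤ κ := by rw [hκ]; positivity
  have hκe : κ * (2 * b + c + 1) = 1 / 2 := by rw [hκ]; field_simp
  have hKZ : 0 ≤ K * Z := mul_nonneg hK hZ
  have h1 : κ * X ≤ κ * (2 * K * Z + b * Y) := mul_le_mul_of_nonneg_left hX hκ0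
  have h2 : κ * (2 * b + c) ≤ 1 / 2 := by nlinarith
  have h3 : κ * (2 * b + c) * Y ≤ 1 / 2 * Y := mul_le_mul_of_nonneg_right h2 hY0
  have h4 : Y ≤ 8 * κ * (K * Z) + 2 * D := by nlinarith
  have h5 : κ ≤ 1 / 2 := by nlinarith [mul_nonneg hκ0 hb, mul_nonneg hκ0 hc]
  have h6 : κ * b ≤ 1 / 4 := by nlinarith [mul_nonneg hκ0 hc]
  have h7 : b * Y ≤ b * (8 * κ * (K * Z) + 2 * D) := mul_le_mul_of_nonneg_left h4 hb
  have h8 : κ * b * (K * Z) ≤ 1 / 4 * (K * Z) := mul_le_mul_of_nonneg_right h6 hKZ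
  have h9 : κ * (K * Z) ≤ 1 / 2 * (K * Z) := mul_le_mul_of_nonneg_right h5 hKZ
  nlinarith

/-- Squared gradient bound for the cut-off component `η^{k+1} vᵢ`. -/
lemma norm_sq_fderiv_cutoff_mul_le {N : ℕ} {M : ℝ} {k : ℕ} {η v : EuclideanSpace ℝ (Fin N) → ℝ}
    {x : EuclideanSpace ℝ (Fin N)} (hη : DifferentiableAt ℝ η x) (hv : DifferentiableAt ℝ v x)
    (hM : ∀ i, |fderiv ℝ η x (EuclideanSpace.single i 1)| ≤ M) :
    ‖fderiv ℝ (fun y => η y ^ (k + 1) * v y) x‖ ^ 2 ≤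
      2 * ((η x ^ (k + 1)) ^ 2 * ∑ j, fderiv ℝ v x (EuclideanSpace.single j 1) ^ 2) +
        2 * N * (k + 1) ^ 2 * M ^ 2 * ((η x ^ k) ^ 2 * v x ^ 2) := by
  refine (norm_sq_le_sum_sq_apply_single _).trans ?_
  have hd : ∀ j : Fin N, fderiv ℝ (fun y => η y ^ (k + 1) * v y) x (EuclideanSpace.single j 1) =
      η x ^ (k + 1) * fderiv ℝ v x (EuclideanSpace.single j 1) +
        (k + 1) * η x ^ k * v x * fderiv ℝ η x (EuclideanSpace.single j 1) := by
    intro j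
    have h1 : HasFDerivAt (fun y => η y ^ (k + 1) * v y) _ x :=
      (hη.hasFDerivAt.pow (k + 1)).mul hv.hasFDerivAt
    rw [h1.fderiv]
    simp only [add_apply, smul_apply, smul_eq_mul, nsmul_eq_mul, Nat.add_sub_cancel]
    push_cast
    ring
  have hsum : 2 * ((η x ^ (k + 1)) ^ 2 * ∑ j, fderiv ℝ v x (EuclideanSpace.single j 1) ^ 2) +
        2 * N * (k + 1) ^ 2 * M ^ 2 * ((η x ^ k) ^ 2 * v x ^ 2) =
      ∑ j : Fin N, (2 * ((η x ^ (k + 1)) ^ 2 * fderiv ℝ v x (EuclideanSpace.single j 1) ^ 2) +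
        2 * ((k + 1) ^ 2 * ((η x ^ k) ^ 2 * v x ^ 2) * M ^ 2)) := by
    simp only [Finset.sum_add_distrib, Finset.sum_const, Finset.card_univ, Fintype.card_fin,
      nsmul_eq_mul, Finset.mul_sum]
    ring
  rw [hsum]
  refine Finset.sum_le_sum fun j _ => ?_
  rw [hd]
  have hg : fderiv ℝ η x (EuclideanSpace.single j 1) ^ 2 ≤ M ^ 2 :=
    sq_le_sq' (by linarith [abs_le.1 (hM j)]) (abs_le.1 (hM j)).2
  have h2 : 0 ≤ (k + 1 : ℝ) ^ 2 * ((η x ^ k) ^ 2 * v x ^ 2) := by positivity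
  nlinarith [mul_le_mul_of_nonneg_left hg h2, sq_nonneg
    (η x ^ (k + 1) * fderiv ℝ v x (EuclideanSpace.single j 1) -
      (k + 1) * η x ^ k * v x * fderiv ℝ η x (EuclideanSpace.single j 1))]

/-- Solving the last identity gives `q = 2kθ / ((k+1)θ - 2)`. Then `q ≥ 2` amounts to `θ ≤ 2`, and
`q` tends to `2` as `k` grows, so a large `k` makes it subcritical for Sobolev; `k ≥ 2N/θ` suffices.
-/
lemma exists_interpolation_exponents {N : ℕ} (hN : 0 < N) {θ : ℝ} (hθ0 : 0 < θ) (hθ2 : θ ≤ 2) :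
    ∃ (k : ℕ) (q : ℝ≥0), 0 < k ∧ 2 ≤ q ∧ 1 / 2 - 1 / (2 * (N : ℝ)) ≤ 1 / (q : ℝ) ∧
      2 * k / (k + 1) / (q : ℝ) + 2 / (k + 1) / θ = 1 := by
  have hN' : (1 : ℝ) ≤ N := by exact_mod_cast hN
  obtain ⟨k, hk⟩ := exists_nat_ge (2 * N / θ)
  have hkθ : 2 * N ≤ k * θ := (div_le_iff₀ hθ0).1 hk
  have hk0 : (0 : ℝ) < k := lt_of_lt_of_le (by positivity) hk
  have hd : 0 < (k + 1) * θ - 2 := by nlinarith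
  have hq0 : 0 ≤ 2 * k * θ / ((k + 1) * θ - 2) := by positivity
  refine ⟨k, (2 * k * θ / ((k + 1) * θ - 2)).toNNReal, by exact_mod_cast hk0, ?_, ?_, ?_⟩
  · rw [← NNReal.coe_le_coe]
    simp only [Real.coe_toNNReal _ hq0, NNReal.coe_ofNat]
    rw [le_div_iff₀ hd]
    linarith
  · rw [Real.coe_toNNReal _ hq0]
    rw [one_div_div, div_sub_div _ _ (by norm_num) (by positivity),
      div_le_div_iff₀ (by positivity) (by positivity)]
    nlinarith
  · rw [Real.coe_toNNReal _ hq0]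
    field_simp
    ring

theorem exists_sq_eLpNorm_add_sq_eLpNorm_jacobian_le {N : ℕ} (hN : 0 < N) {K θ r s : ℝ}
    (hK : 0 ≤ K) (hθ0 : 0 < θ) (hθ2 : θ ≤ 2) (hr : 0 < r) (hrs : r < s) :
    ∃ C : ℝ≥0, 0 < C ∧ ∀ (x₀ : EuclideanSpace ℝ (Fin N))
      (V : EuclideanSpace ℝ (Fin N) → EuclideanSpace ℝ (Fin N)), ContDiff ℝ 1 V →
      HasCompactSupport V →
      (∀ x ∈ Metric.ball x₀ s,
        ∑ i, ∑ j, jacobian V x i j ^ 2 ≤ K * (jacobian V x * jacobian V x).trace) →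
      eLpNorm V 2 (volume.restrict (Metric.ball x₀ r)) ^ 2 +
          eLpNorm (fun x => frobNorm (jacobian V x)) 2 (volume.restrict (Metric.ball x₀ r)) ^ 2 ≤
        ENNReal.ofReal (8 * K) *
            eLpNorm (fun x => (jacobian V x).trace) 2 (volume.restrict (Metric.ball x₀ s)) ^ 2 +
          C * eLpNorm V (ENNReal.ofReal θ) (volume.restrict (Metric.ball x₀ s)) ^ 2 := by
  obtain ⟨k, q, hk, hq2, hqN, hexp⟩ := exists_interpolation_exponents hN hθ0 hθ2
  obtain ⟨M, hcut⟩ := exists_cutoff N hr hrs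
  obtain ⟨S₀, hS₀⟩ := exists_eLpNorm_le_mul_eLpNorm_fderiv_two hN hq2 hqN s
  have hN' : (0 : ℝ) < N := by exact_mod_cast hN
  -- Adding `1` makes the constant positive, so that `δ` may be defined by dividing by it.
  set S : ℝ≥0 := S₀ + 1 with hSdef
  have hS0 : 0 < S := by positivity
  set b : ℝ := 2 * ((N ^ 2 + N) * K ^ 2 * (2 * k + 2) ^ 2 * M ^ 2) with hbdef
  set c : ℝ := 2 * N * (k + 1) ^ 2 * M ^ 2 with hcdef
  have hb0 : 0 ≤ b := by positivity
  have hc0 : 0 ≤ c := by positivity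
  set κ : ℝ := 1 / (2 * (2 * b + c + 1)) with hκ
  have hκ0 : 0 < κ := by positivity
  have hSr : (0 : ℝ) < S := hS0
  -- Chosen so that `N δ S² = κ`, since the interpolation is summed over the `N` components.
  set δ : ℝ≥0 := (κ / (N * S ^ 2)).toNNReal with hδdef
  have hδ0 : 0 < δ := Real.toNNReal_pos.2 (by positivity)
  have hδe : N * (δ * S ^ 2 : ℝ) = κ := by
    rw [hδdef, Real.coe_toNNReal _ (by positivity)]
    field_simp
  set C : ℝ≥0 := (2 * b.toNNReal + 2) * (N * (δ⁻¹) ^ k) with hCdef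
  have hC0 : 0 < C := by
    have : (0 : ℝ≥0) < N := by exact_mod_cast hN
    positivity
  refine ⟨C, hC0, fun x₀ V hV hVc hineq => ?_⟩
  set T := eLpNorm V (ENNReal.ofReal θ) (volume.restrict (Metric.ball x₀ s)) with hT
  -- For `T = ∞` the right-hand side is infinite because `C > 0`; otherwise all quantities are
  -- finite and the absorption can take place in `ℝ`.
  rcases eq_or_ne T ⊤ with hTtop | hTtop
  · rw [hTtop]
    simp [hC0.ne']
  obtain ⟨η, hη, hηc, hηs, hη1, hη0, hηle, hηM⟩ := hcut x₀
  have hVi : ∀ i, ContDiff ℝ 1 fun x => V x i := fun i =>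
    (EuclideanSpace.proj i : EuclideanSpace ℝ (Fin N) →L[ℝ] ℝ).contDiff.comp hV
  have hVic : ∀ i, Continuous fun x => V x i := fun i => (hVi i).continuous
  have hJc := continuous_jacobian hV
  have hJ : ∀ x i j, jacobian V x i j = fderiv ℝ (fun y => V y i) x (EuclideanSpace.single j 1) :=
    fun x => jacobian_apply_eq_fderiv (hV.differentiable one_ne_zero x)
  have hηcont := hη.continuous
  have hηout : ∀ x, x ∉ Metric.ball x₀ s → η x = 0 := fun x hx =>
    image_eq_zero_of_notMem_tsupport fun h => hx (hηs h)
  have hcs : ∀ (n : ℕ) (g : EuclideanSpace ℝ (Fin N) → ℝ),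
      HasCompactSupport fun x => (η x ^ (n + 1)) ^ 2 * g x := fun n g =>
    (hηc.comp_left (g := fun y => (y ^ (n + 1)) ^ 2) (by simp)).mul_right
  have hcs' : ∀ g : EuclideanSpace ℝ (Fin N) → ℝ,
      HasCompactSupport fun x => (η x ^ k) ^ 2 * g x := fun g => by
    obtain ⟨n, rfl⟩ := Nat.exists_eq_succ_of_ne_zero hk.ne'
    exact hcs n g
  have hIX : Integrable (fun x => (η x ^ (k + 1)) ^ 2 * ∑ i, ∑ j, jacobian V x i j ^ 2) volume :=
    Continuous.integrable_of_hasCompactSupport (by fun_prop) (hcs k _)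
  have hIY : Integrable (fun x => (η x ^ k) ^ 2 * ∑ i, V x i ^ 2) volume :=
    Continuous.integrable_of_hasCompactSupport (by fun_prop) (hcs' _)
  have hIZ : Integrable (fun x => (η x ^ (k + 1)) ^ 2 * (jacobian V x).trace ^ 2) volume := by
    simp only [Matrix.trace, Matrix.diag]
    exact Continuous.integrable_of_hasCompactSupport (by fun_prop) (hcs k _)
  have hX0 : ∀ x, 0 ≤ (η x ^ (k + 1)) ^ 2 * ∑ i, ∑ j, jacobian V x i j ^ 2 := fun x => by
    positivity
  have hY0 : ∀ x, 0 ≤ (η x ^ k) ^ 2 * ∑ i, V x i ^ 2 := fun x => by positivity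
  have hZ0 : ∀ x, 0 ≤ (η x ^ (k + 1)) ^ 2 * (jacobian V x).trace ^ 2 := fun x => by positivity
  set X := ∫ x, (η x ^ (k + 1)) ^ 2 * ∑ i, ∑ j, jacobian V x i j ^ 2 with hX
  set Y := ∫ x, (η x ^ k) ^ 2 * ∑ i, V x i ^ 2 with hY
  set Z := ∫ x, (η x ^ (k + 1)) ^ 2 * (jacobian V x).trace ^ 2 with hZ
  have hXn : 0 ≤ X := integral_nonneg hX0
  have hYn : 0 ≤ Y := integral_nonneg hY0
  have hZn : 0 ≤ Z := integral_nonneg hZ0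
  have hcacc : X ≤ 2 * K * Z + b * Y :=
    integral_cutoff_mul_sum_sq_jacobian_le k hV hVc hη hηM fun x hx =>
      hineq x (by_contra fun h => hx (hηout x h))
  have hoX : ENNReal.ofReal X =
      ∫⁻ x, ENNReal.ofReal ((η x ^ (k + 1)) ^ 2 * ∑ i, ∑ j, jacobian V x i j ^ 2) :=
    ofReal_integral_eq_lintegral_ofReal hIX (Filter.Eventually.of_forall hX0)
  have hoY : ENNReal.ofReal Y = ∫⁻ x, ENNReal.ofReal ((η x ^ k) ^ 2 * ∑ i, V x i ^ 2) :=
    ofReal_integral_eq_lintegral_ofReal hIY (Filter.Eventually.of_forall hY0)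
  have hoZ : ENNReal.ofReal Z =
      ∫⁻ x, ENNReal.ofReal ((η x ^ (k + 1)) ^ 2 * (jacobian V x).trace ^ 2) :=
    ofReal_integral_eq_lintegral_ofReal hIZ (Filter.Eventually.of_forall hZ0)
  have henorm : ∀ a : ℝ, ‖a‖ₑ ^ 2 = ENNReal.ofReal (a ^ 2) := fun a => by
    rw [Real.enorm_eq_ofReal_abs, ← ENNReal.ofReal_pow (abs_nonneg a), sq_abs]
  have hgrad : ∀ i, eLpNorm (fderiv ℝ fun x => η x ^ (k + 1) * V x i) 2 volume ^ 2 ≤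
      ENNReal.ofReal (2 * X + c * Y) := by
    intro i
    have hI : Integrable (fun x =>
        2 * ((η x ^ (k + 1)) ^ 2 * ∑ i, ∑ j, jacobian V x i j ^ 2) +
          c * ((η x ^ k) ^ 2 * ∑ i, V x i ^ 2)) volume :=
      (hIX.const_mul 2).add (hIY.const_mul c)
    have hcalc : 2 * X + c * Y = ∫ x, (2 * ((η x ^ (k + 1)) ^ 2 * ∑ i, ∑ j, jacobian V x i j ^ 2) +
        c * ((η x ^ k) ^ 2 * ∑ i, V x i ^ 2)) := by
      rw [integral_add (hIX.const_mul 2) (hIY.const_mul c), integral_const_mul,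
        integral_const_mul]
    rw [eLpNorm_two_sq, hcalc, ofReal_integral_eq_lintegral_ofReal hI
      (Filter.Eventually.of_forall fun x => by
        exact add_nonneg (mul_nonneg zero_le_two (hX0 x)) (mul_nonneg hc0 (hY0 x)))]
    refine lintegral_mono fun x => ?_
    rw [← ofReal_norm, ← ENNReal.ofReal_pow (norm_nonneg _)]
    refine ENNReal.ofReal_le_ofReal ((norm_sq_fderiv_cutoff_mul_le
      (hη.differentiable one_ne_zero x) ((hVi i).differentiable one_ne_zero x) (hηM x)).trans ?_)
    simp only [← hJ]
    have h1 : ∑ j, jacobian V x i j ^ 2 ≤ ∑ i, ∑ j, jacobian V x i j ^ 2 :=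
      Finset.single_le_sum (f := fun i => ∑ j, jacobian V x i j ^ 2)
        (fun i _ => Finset.sum_nonneg fun j _ => sq_nonneg _) (Finset.mem_univ i)
    have h2 : V x i ^ 2 ≤ ∑ i, V x i ^ 2 :=
      Finset.single_le_sum (f := fun i => V x i ^ 2) (fun i _ => sq_nonneg _) (Finset.mem_univ i)
    change _ ≤ 2 * ((η x ^ (k + 1)) ^ 2 * ∑ i, ∑ j, jacobian V x i j ^ 2) +
        c * ((η x ^ k) ^ 2 * ∑ i, V x i ^ 2)
    gcongr
  have hcomp : ∀ i, ∫⁻ x, ‖η x ^ k * V x i‖ₑ ^ 2 ≤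
      δ * (S ^ 2 * ENNReal.ofReal (2 * X + c * Y)) + (δ⁻¹ : ℝ≥0) ^ k * T ^ 2 := by
    intro i
    have hWs : tsupport (fun x => η x ^ (k + 1) * V x i) ⊆ Metric.ball x₀ s := by
      refine (tsupport_mul_subset_left).trans (Set.Subset.trans ?_ hηs)
      exact closure_mono fun x hx h => hx (by simp [h])
    have hWc : HasCompactSupport (fun x => η x ^ (k + 1) * V x i) :=
      (hηc.comp_left (g := fun y => y ^ (k + 1)) (by simp)).mul_right
    have hsob := hS₀ x₀ (fun x => η x ^ (k + 1) * V x i) ((hη.pow _).mul (hVi i)) hWc hWs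
    have hSS : (S₀ : ℝ≥0∞) ≤ S := by
      exact_mod_cast (le_self_add : S₀ ≤ S₀ + 1)
    refine (lintegral_cutoff_sq_le_add (B := Metric.ball x₀ s) hk hθ0
      (lt_of_lt_of_le (by norm_num) hq2) hδ0.ne' hexp hηcont.aemeasurable
      (hVic i).aemeasurable hηout).trans ?_
    refine add_le_add (mul_le_mul' le_rfl ?_) (mul_le_mul' le_rfl ?_)
    · calc _ ≤ (S * eLpNorm (fderiv ℝ fun x => η x ^ (k + 1) * V x i) 2 volume) ^ 2 := by
            gcongr
            exact hsob.trans (by gcongr)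
        _ ≤ _ := by
            rw [mul_pow]
            gcongr
            exact hgrad i
    · refine pow_le_pow_left' (eLpNorm_mono fun x => ?_) 2
      exact PiLp.norm_apply_le (V x) i
  have hYle : ENNReal.ofReal Y ≤
      N * (δ * (S ^ 2 * ENNReal.ofReal (2 * X + c * Y)) + (δ⁻¹ : ℝ≥0) ^ k * T ^ 2) := by
    have h1 : ∀ x, ENNReal.ofReal ((η x ^ k) ^ 2 * ∑ i, V x i ^ 2) =
        ∑ i, ‖η x ^ k * V x i‖ₑ ^ 2 := by
      intro x
      simp only [henorm]
      rw [← ENNReal.ofReal_sum_of_nonneg fun i _ => sq_nonneg _, Finset.mul_sum]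
      simp only [mul_pow]
    rw [hoY]
    simp only [h1]
    rw [lintegral_finsetSum' _ fun i _ => by
      have := hVic i
      exact (by fun_prop : Continuous fun x => η x ^ k * V x i).aemeasurable.enorm.pow_const 2]
    calc _ ≤ ∑ _i : Fin N, (δ * (S ^ 2 * ENNReal.ofReal (2 * X + c * Y)) +
          ((δ⁻¹ : ℝ≥0) : ℝ≥0∞) ^ k * T ^ 2) := Finset.sum_le_sum fun i _ => hcomp i
      _ = _ := by simp [mul_add]
  have hTreal : T = ENNReal.ofReal T.toReal := (ENNReal.ofReal_toReal hTtop).symm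
  set t := T.toReal
  have ht0 : 0 ≤ t := ENNReal.toReal_nonneg
  have hsum0 : 0 ≤ 2 * X + c * Y := by positivity
  have hYreal : Y ≤ κ * (2 * X + c * Y) + N * ((δ⁻¹ : ℝ≥0) ^ k * t ^ 2) := by
    have h1 : (N : ℝ≥0∞) * (δ * (S ^ 2 * ENNReal.ofReal (2 * X + c * Y)) +
        ((δ⁻¹ : ℝ≥0) : ℝ≥0∞) ^ k * T ^ 2) =
        ENNReal.ofReal (N * (δ * (S ^ 2 * (2 * X + c * Y)) + (δ⁻¹ : ℝ≥0) ^ k * t ^ 2)) := by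
      have hδn := NNReal.coe_nonneg (δ⁻¹)
      generalize 2 * X + c * Y = P at hsum0
      rw [hTreal, ENNReal.ofReal_mul hN'.le, ENNReal.ofReal_natCast,
        ENNReal.ofReal_add (by positivity) (by positivity),
        ENNReal.ofReal_mul (NNReal.coe_nonneg δ), ENNReal.ofReal_mul (sq_nonneg (S : ℝ)),
        ENNReal.ofReal_pow hSr.le, ENNReal.ofReal_mul (pow_nonneg hδn k),
        ENNReal.ofReal_pow hδn, ENNReal.ofReal_pow ht0]
      simp only [ENNReal.ofReal_coe_nnreal]
    rw [h1, ENNReal.ofReal_le_ofReal_iff (by positivity)] at hYle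
    rw [← hδe]
    refine hYle.trans_eq ?_
    ring
  have hfinal := absorb_of_le_of_le hb0 hc0 hK hZn hYn hκ hcacc hYreal
  have hXball : eLpNorm (fun x => frobNorm (jacobian V x)) 2
      (volume.restrict (Metric.ball x₀ r)) ^ 2 ≤ ENNReal.ofReal X := by
    rw [eLpNorm_two_sq, hoX]
    refine (setLIntegral_mono' measurableSet_ball fun x hx => ?_).trans
      (setLIntegral_le_lintegral (Metric.ball x₀ r) _)
    rw [henorm, frobNorm, Real.sq_sqrt (by positivity), hη1 x hx]
    simp
  have hYball : eLpNorm V 2 (volume.restrict (Metric.ball x₀ r)) ^ 2 ≤ ENNReal.ofReal Y := by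
    rw [eLpNorm_two_sq, hoY]
    refine (setLIntegral_mono' measurableSet_ball fun x hx => ?_).trans
      (setLIntegral_le_lintegral (Metric.ball x₀ r) _)
    rw [← ofReal_sum_sq_eq_enorm_sq, hη1 x hx]
    simp
  have hZball : ENNReal.ofReal Z ≤
      eLpNorm (fun x => (jacobian V x).trace) 2 (volume.restrict (Metric.ball x₀ s)) ^ 2 := by
    rw [eLpNorm_two_sq, hoZ, ← setLIntegral_eq_of_support_subset (s := Metric.ball x₀ s)]
    · refine lintegral_mono fun x => ?_
      rw [henorm]
      refine ENNReal.ofReal_le_ofReal (mul_le_of_le_one_left (sq_nonneg _) ?_)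
      exact pow_le_one₀ (pow_nonneg (hη0 x) _) (pow_le_one₀ (hη0 x) (hηle x))
    · intro x hx
      by_contra h
      simp [hηout x h] at hx
  calc _ ≤ ENNReal.ofReal Y + ENNReal.ofReal X := add_le_add hYball hXball
    _ = ENNReal.ofReal (X + Y) := by rw [add_comm X Y, ENNReal.ofReal_add hYn hXn]
    _ ≤ ENNReal.ofReal (8 * K * Z + (2 * b + 2) * (N * ((δ⁻¹ : ℝ≥0) ^ k * t ^ 2))) :=
        ENNReal.ofReal_le_ofReal hfinal
    _ = ENNReal.ofReal (8 * K) * ENNReal.ofReal Z + C * T ^ 2 := by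
        have hCr : (2 * b + 2) * (N * ((δ⁻¹ : ℝ≥0) ^ k * t ^ 2)) = (C : ℝ) * t ^ 2 := by
          rw [hCdef]
          push_cast
          rw [Real.coe_toNNReal _ hb0]
          ring
        rw [hCr, ENNReal.ofReal_add (by positivity) (by positivity),
          ENNReal.ofReal_mul (by positivity), ENNReal.ofReal_mul (NNReal.coe_nonneg C),
          ENNReal.ofReal_coe_nnreal, ENNReal.ofReal_pow ht0, ← hTreal]
    _ ≤ _ := by gcongr

end InteriorEstimate

/-! ### Localization and the main theorem. -/

lemma not_isQuasiuniformlyConvex_of_dim_zero {K : ℝ}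
    {F : EuclideanSpace ℝ (Fin 0) → ℝ} : ¬ IsQuasiuniformlyConvex K F := fun hF =>
  hF.not_affine ⟨0, F 0, fun z => by simp [Subsingleton.elim z 0]⟩

lemma sobolevNorm_le_of_sq_le {N : ℕ} {V : EuclideanSpace ℝ (Fin N) → EuclideanSpace ℝ (Fin N)}
    {Ω : Set (EuclideanSpace ℝ (Fin N))} {a b : ℝ≥0} {A B : ℝ≥0∞} (hΩ : IsOpen Ω)
    (hV : ContDiffOn ℝ 1 V Ω)
    (h : eLpNorm V 2 (volume.restrict Ω) ^ 2 +
      eLpNorm (fun x => frobNorm (jacobian V x)) 2 (volume.restrict Ω) ^ 2 ≤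
        a * A ^ 2 + b * B ^ 2) :
    sobolevNorm Ω V ≤ NNReal.sqrt a * A + NNReal.sqrt b * B := by
  have hsqrt : ∀ (c : ℝ≥0) (D : ℝ≥0∞), (c * D ^ 2) ^ (1 / 2 : ℝ) = NNReal.sqrt c * D := by
    intro c D
    rw [ENNReal.mul_rpow_of_nonneg _ _ (by norm_num), NNReal.sqrt_eq_rpow,
      ENNReal.coe_rpow_of_nonneg _ (by norm_num), ← ENNReal.rpow_natCast, ← ENNReal.rpow_mul]
    norm_num
  calc sobolevNorm Ω V ≤ _ := iInf₂_le (jacobian V) (hasWeakDeriv_jacobian hΩ hV)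
    _ ≤ (a * A ^ 2 + b * B ^ 2) ^ (1 / 2 : ℝ) := by gcongr
    _ ≤ (a * A ^ 2) ^ (1 / 2 : ℝ) + (b * B ^ 2) ^ (1 / 2 : ℝ) :=
      ENNReal.rpow_add_le_add_rpow _ _ (by norm_num) (by norm_num)
    _ = _ := by rw [hsqrt, hsqrt]

theorem theorem3p2 (N : ℕ) (K θ : ℝ) (hK : 1 ≤ K) (hθ0 : 0 < θ) (hθ2 : θ ≤ 2) :
    ∃ C : ℝ≥0, 0 < C ∧ ∀ R : ℝ, 0 < R → ∃ CR : ℝ≥0, 0 < CR ∧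
      ∀ (x₀ : EuclideanSpace ℝ (Fin N)) (F u f : EuclideanSpace ℝ (Fin N) → ℝ),
        IsQuasiuniformlyConvex K F → ContDiff ℝ 2 F →
        ContDiffOn ℝ 2 u (Metric.ball x₀ (2 * R)) →
        (∀ᵐ x ∂(volume.restrict (Metric.ball x₀ (2 * R))), divergence (stressField F u) x = f x) →
        sobolevNorm (Metric.ball x₀ R) (stressField F u) ≤
          C * eLpNorm f 2 (volume.restrict (Metric.ball x₀ (2 * R)))
            + CR * eLpNorm (stressField F u) (ENNReal.ofReal θ)
                (volume.restrict (Metric.ball x₀ (2 * R))) := by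
  rcases Nat.eq_zero_or_pos N with rfl | hN
  · exact ⟨1, one_pos, fun R _ => ⟨1, one_pos, fun x₀ F u f hF =>
      (not_isQuasiuniformlyConvex_of_dim_zero hF).elim⟩⟩
  -- The constant is fixed before `R` is introduced; this is possible because the interior estimate
  -- has the factor `8K` for every pair of radii.
  refine ⟨NNReal.sqrt (8 * K).toNNReal,
    NNReal.sqrt_pos.2 (Real.toNNReal_pos.2 (by positivity)), fun R hR => ?_⟩
  obtain ⟨C, hC0, hC⟩ := exists_sq_eLpNorm_add_sq_eLpNorm_jacobian_le hN
    (by linarith : 0 ≤ K) hθ0 hθ2 hR (by linarith : R < 3 / 2 * R)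
  obtain ⟨M, hcut⟩ := exists_cutoff N (by linarith : 0 < 3 / 2 * R)
    (by linarith : 3 / 2 * R < 2 * R)
  refine ⟨NNReal.sqrt C, NNReal.sqrt_pos.2 hC0, fun x₀ F u f hF hF2 hu hf => ?_⟩
  obtain ⟨χ, hχ, hχc, hχs, hχ1, -⟩ := hcut x₀
  set V := stressField F u with hVdef
  have hat : ∀ x ∈ Metric.ball x₀ (2 * R), ContDiffAt ℝ 2 u x := fun x hx =>
    hu.contDiffAt (Metric.isOpen_ball.mem_nhds hx)
  have hVat : ∀ x ∈ Metric.ball x₀ (2 * R), ContDiffAt ℝ 1 V x := fun x hx =>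
    contDiffAt_stressField hF2 (hat x hx)
  have hsub : Metric.ball x₀ R ⊆ Metric.ball x₀ (3 / 2 * R) :=
    Metric.ball_subset_ball (by linarith)
  have hsub' : Metric.ball x₀ (3 / 2 * R) ⊆ Metric.ball x₀ (2 * R) :=
    Metric.ball_subset_ball (by linarith)
  -- `V` is `C¹` only in the large ball. Its product with a cutoff equal to `1` on the ball of
  -- radius `3R/2` is a global `C¹` field, to which the interior estimate between radii `R` and
  -- `3R/2` applies.
  set W : EuclideanSpace ℝ (Fin N) → EuclideanSpace ℝ (Fin N) := fun x => χ x • V x with hW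
  have hWd : ContDiff ℝ 1 W := contDiff_iff_contDiffAt.2 fun x => by
    by_cases hx : x ∈ tsupport χ
    · exact hχ.contDiffAt.smul (hVat x (hχs hx))
    · refine (contDiffAt_const (c := 0)).congr_of_eventuallyEq ?_
      filter_upwards [notMem_tsupport_iff_eventuallyEq.1 hx] with y hy
      simp [hW, hy]
  have hWc : HasCompactSupport W := hχc.smul_right
  have hWV : ∀ x ∈ Metric.ball x₀ (3 / 2 * R), W x = V x := fun x hx => by
    simp [hW, hχ1 x hx]
  have hJ : ∀ x ∈ Metric.ball x₀ (3 / 2 * R), jacobian W x = jacobian V x := by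
    intro x hx
    have : W =ᶠ[nhds x] V := Filter.eventually_of_mem (Metric.isOpen_ball.mem_nhds hx) hWV
    ext i j
    rw [jacobian_apply, jacobian_apply, this.fderiv_eq]
  have hmain := hC x₀ W hWd hWc fun x hx => by
    rw [hJ x hx]
    exact hF.sum_sq_jacobian_stressField_le hF2 (hat x (hsub' hx))
  have hcongr : ∀ {ρ : ℝ} {G : Type} [NormedAddCommGroup G] {p : ℝ≥0∞}
      {g h : EuclideanSpace ℝ (Fin N) → G}, (∀ x ∈ Metric.ball x₀ ρ, g x = h x) →
      eLpNorm g p (volume.restrict (Metric.ball x₀ ρ)) =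
        eLpNorm h p (volume.restrict (Metric.ball x₀ ρ)) := fun h =>
    eLpNorm_congr_ae ((ae_restrict_iff' measurableSet_ball).2 (Filter.Eventually.of_forall h))
  rw [hcongr fun x hx => hWV x (hsub hx), hcongr hWV,
    hcongr (g := fun x => frobNorm (jacobian W x)) (h := fun x => frobNorm (jacobian V x))
      fun x hx => by rw [hJ x (hsub hx)],
    hcongr (g := fun x => (jacobian W x).trace) (h := fun x => (jacobian V x).trace)
      fun x hx => by rw [hJ x hx]] at hmain
  refine sobolevNorm_le_of_sq_le Metric.isOpen_ball
    (fun x hx => (hVat x (hsub' (hsub hx))).contDiffWithinAt) (hmain.trans ?_)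
  have hdiv : eLpNorm (fun x => (jacobian V x).trace) 2
      (volume.restrict (Metric.ball x₀ (3 / 2 * R))) ≤
        eLpNorm f 2 (volume.restrict (Metric.ball x₀ (2 * R))) :=
    (eLpNorm_mono_measure _ (Measure.restrict_mono hsub' le_rfl)).trans_eq (eLpNorm_congr_ae hf)
  have hθle := eLpNorm_mono_measure (p := ENNReal.ofReal θ) V
    (Measure.restrict_mono hsub' (le_refl (volume : Measure (EuclideanSpace ℝ (Fin N)))))
  change ((8 * K).toNNReal : ℝ≥0∞) * _ + _ ≤ _
  gcongr
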